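/- Let $\mathcal C=(\mathcal C,\otimes,c,[-,-])$ be a closed symmetric monoidal category whose underlying category has all finite limits and all finite colimits; regard $\mathcal C$ as enriched over itself by $\mathcal C(x,y)=[x,y]$. Let $\mathfrak b=(b,u_b,m_b)$ be a monoid in $\mathcal C$. Let $\mathrm{Mod}_{\mathfrak b}$ be the $\mathcal C$-enriched category of right $\mathfrak b$-modules $(z,\gamma_z\colon z\otimes b\to z)$, whose Hom object from $(z,\gamma_z)$ to $(z',\gamma_{z'})$ is the equalizer of the two morphisms $(\gamma_z)^{\star}$ and $(\gamma_{z'})_{\star}\circ(-\otimes b)_{z,z'}$ from $[z,z']$ to $[z\otimes b,z']$. Let $\mathcal D$ be a $\mathcal C$-enriched category with underlying category $\mathcal D_0$. Assume that $\mathcal D$ is tensored, i.e. for every object $X$ the $\mathcal C$-enriched Hom functor $\mathcal D(X,-)\colon\mathcal D\to\mathcal C$ has a $\mathcal C$-enriched left adjoint $-\circledast X\colon\mathcal C\to\mathcal D$, and that $\mathcal D_0$ has coequalizers. For an object $X$ of $\mathcal D$ let $\mathrm{End}_{\mathcal D}(X)$ be the monoid $\mathcal D(X,X)$ in $\mathcal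 C$ with unit the identity of $X$ and multiplication the composition $\mathcal D(X,X)\otimes\mathcal D(X,X)\to\mathcal D(X,X)$, $g\otimes f\mapsto g\circ f$. An object $X$ of $\mathcal D$ is called a *$\mathcal C$-enriched compact generator* if - $\mathcal D(X,-)$ preserves $\mathcal C$-tensors: for all $z\in\mathcal C$ and $Y\in\mathcal D$ the tensorial strength $z\otimes\mathcal D(X,Y)\to\mathcal D(X,z\circledast Y)$ is an isomorphism, where this strength is the composite $$z\otimes\mathcal D(X,Y)\to\mathcal D(Y,z\circledast Y)\otimes\mathcal D(X,Y)\to\mathcal D(X,z\circledast Y)$$ of the unit $z\to\mathcal D(Y,z\circledast Y)$ (tensored with $\mathcal D(X,Y)$) and the composition of $\mathcal D$; - the underlying functor $\mathcal D(X,-)_0\colon\mathcal D_0\to\mathcal C$ preserves coequalizers; - $\mathcal D(X,-)$ is conservative, i.e. $\mathcal D(X,-)_0$ reflects isomorphisms. **Theorem.** The $\mathcal C$-enriched categories $\mathcal D$ and $\mathrm{Mod}_{\mathfrak b}$ are equivalent (there are $\mathcal C$-functors in both directions whose composites are $\mathcal C$-naturally isomorphic to the identities) if and only if there exists a $\mathcal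 C$-enriched compact generator $X$ in $\mathcal D$ together with an isomorphism of monoids $\mathfrak b\cong\mathrm{End}_{\mathcal D}(X)$ in $\mathcal C$. -/

import Mathlib

open CategoryTheory MonoidalCategory Limits
open scoped MonoidalClosed

universe v u w₁ w₂

noncomputable section

namespace EnrichedMorita

/-! ### Enriched natural transformations, adjunctions and equivalences

Mathlib's category structure on `EnrichedFunctor V A B` has as morphisms the natural
transformations between the *underlying* functors, which is weaker than `V`-naturality for
a general base `V`.  We therefore use the following standard definition. -/

section General

variable {V : Type u} [Category.{v} V] [MonoidalCategory V]
variable {A : Type w₁} [EnrichedCategory V A] {B : Type w₂} [EnrichedCategory V B]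

/-- A `V`-natural transformation between `V`-functors. -/
structure EnrichedTrans (F G : EnrichedFunctor V A B) where
  /-- The component at an object. -/
  app (X : A) : 𝟙_ V ⟶ (F.obj X ⟶[V] G.obj X)
  /-- `V`-naturality, as an equation between morphisms out of the Hom object. -/
  naturality (X Y : A) :
    (λ_ (X ⟶[V] Y)).inv ≫ (app X ⊗ₘ G.map X Y) ≫ eComp V (F.obj X) (G.obj X) (G.obj Y) =
      (ρ_ (X ⟶[V] Y)).inv ≫ (F.map X Y ⊗ₘ app Y) ≫ eComp V (F.obj X) (F.obj Y) (G.obj Y)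

/-- The component of a `V`-natural transformation, as a morphism of the underlying category. -/
def EnrichedTrans.appHom {F G : EnrichedFunctor V A B} (τ : EnrichedTrans F G) (X : A) :
    ForgetEnrichment.of V (F.obj X) ⟶ ForgetEnrichment.of V (G.obj X) :=
  ForgetEnrichment.homOf V (τ.app X)

/-- An isomorphism of `V`-functors: a `V`-natural transformation with a `V`-natural inverse. -/
structure EnrichedNatIso (F G : EnrichedFunctor V A B) where
  /-- The transformation. -/
  hom : EnrichedTrans F G
  /-- Its inverse. -/
  inv : EnrichedTrans G F
  hom_inv_id (X : A) : hom.appHom X ≫ inv.appHom X = 𝟙 (ForgetEnrichment.of V (F.obj X))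
  inv_hom_id (X : A) : inv.appHom X ≫ hom.appHom X = 𝟙 (ForgetEnrichment.of V (G.obj X))

/-- A `V`-enriched adjunction `F ⊣ G`, given by a `V`-natural unit and counit which satisfy the
triangle identities. -/
structure EnrichedAdjunction (F : EnrichedFunctor V A B) (G : EnrichedFunctor V B A) where
  /-- The unit. -/
  unit : EnrichedTrans (EnrichedFunctor.id V A) (F.comp V G)
  /-- The counit. -/
  counit : EnrichedTrans (G.comp V F) (EnrichedFunctor.id V B)
  left_triangle (X : A) :
    F.forget.map (unit.appHom X) ≫ counit.appHom (F.obj X) =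
      𝟙 (ForgetEnrichment.of V (F.obj X))
  right_triangle (Y : B) :
    unit.appHom (G.obj Y) ≫ G.forget.map (counit.appHom Y) =
      𝟙 (ForgetEnrichment.of V (G.obj Y))

variable (V A B) in
/-- An equivalence of `V`-enriched categories: `V`-functors in both directions which are
mutually inverse up to `V`-natural isomorphism. -/
structure EnrichedEquivalence where
  /-- The functor from left to right. -/
  functor : EnrichedFunctor V A B
  /-- The functor from right to left. -/
  inverse : EnrichedFunctor V B A
  /-- The first composite is isomorphic to the identity. -/
  unitIso : EnrichedNatIso (EnrichedFunctor.id V A) (functor.comp V inverse)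
  /-- The second composite is isomorphic to the identity. -/
  counitIso : EnrichedNatIso (inverse.comp V functor) (EnrichedFunctor.id V B)

/-- A `V`-functor is conservative if its underlying functor reflects isomorphisms. -/
def IsConservative (F : EnrichedFunctor V A B) : Prop :=
  F.forget.ReflectsIsomorphisms

/-- The underlying functor of a `V`-functor preserves coequalizers. -/
def PreservesCoequalizers (F : EnrichedFunctor V A B) : Prop :=
  PreservesColimitsOfShape WalkingParallelPair F.forget

end General

/-! ### Enriched Hom functors, tensors and tensorial strengths

From here on the base `C` is a closed symmetric monoidal category, enriched over itself by its
internal Hom.  Mathlib's composition `eComp C X Y Z` goes from `(X ⟶[C] Y) ⊗ (Y ⟶[C] Z)`, and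
its internal Hom `(ihom x).obj` is right adjoint to `x ⊗ -`; the symmetry translates between
these and the mirrored conventions. -/

section Closed

variable (C : Type u) [Category.{v} C] [MonoidalCategory C]

section Hom

variable [MonoidalClosed C]

variable {C} in
/-- The transpose of a composite in the self-enrichment. -/
lemma uncurry_tensor_comp {P Q x y z : C} (p : P ⟶ (ihom x).obj y) (q : Q ⟶ (ihom y).obj z) :
    MonoidalClosed.uncurry ((p ⊗ₘ q) ≫ MonoidalClosed.comp x y z) =
      (α_ x P Q).inv ≫ MonoidalClosed.uncurry p ▷ Q ≫ MonoidalClosed.uncurry q := by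
  rw [MonoidalClosed.uncurry_natural_left,
    MonoidalClosed.comp_eq, MonoidalClosed.uncurry_curry, MonoidalClosed.compTranspose_eq,
    MonoidalClosed.uncurry_eq, MonoidalClosed.uncurry_eq, MonoidalCategory.tensorHom_def]
  simp only [MonoidalCategory.whiskerLeft_comp, comp_whiskerRight, Category.assoc]
  rw [associator_inv_naturality_right_assoc, associator_inv_naturality_middle_assoc,
    whisker_exchange_assoc]
  rfl

variable {D : Type w₁} [EnrichedCategory C D]

/-- The `C`-enriched Hom functor `D(X, -) : D ⥤ C`, given on Hom objects by the transpose
of composition. -/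
def homFunctor (X : D) : EnrichedFunctor C D C where
  obj Y := EnrichedCategory.Hom X Y
  map Y Z := MonoidalClosed.curry (eComp C X Y Z)
  map_id Y := by
    rw [← MonoidalClosed.curry_natural_left, MonoidalClosed.enrichedCategorySelf_id,
      MonoidalClosed.id_eq]
    congr 1
    rw [← cancel_epi (ρ_ _).inv, e_comp_id, Iso.inv_hom_id]
  map_comp Y Z W := by
    apply MonoidalClosed.uncurry_injective
    refine Eq.trans ?_ (uncurry_tensor_comp _ _).symm
    rw [MonoidalClosed.uncurry_natural_left]
    simp only [MonoidalClosed.uncurry_curry]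
    rw [e_assoc]

end Hom

/-- A `C`-enriched category is tensored if every enriched Hom functor `D(X, -) : D ⥤ C` has a
`C`-enriched left adjoint `- ⊛ X : C ⥤ D`.  The class records a choice of these adjoints. -/
class Tensored [MonoidalClosed C] (D : Type w₁) [EnrichedCategory C D] where
  /-- The functor `- ⊛ X`. -/
  tensor (X : D) : EnrichedFunctor C C D
  /-- The adjunction `- ⊛ X ⊣ D(X, -)`. -/
  adj (X : D) : EnrichedAdjunction (tensor X) (homFunctor C X)

section Strength

variable [MonoidalClosed C]

variable {C} in
/-- A morphism of `C`, seen in the underlying category of the self-enriched category `C`. -/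
def toUnderlying {x y : C} (f : x ⟶ y) :
    ForgetEnrichment.of C x ⟶ ForgetEnrichment.of C y :=
  ForgetEnrichment.homOf C (MonoidalClosed.curry' f)

variable {C}
variable {D : Type w₁} [EnrichedCategory C D] [Tensored C D]
variable {D' : Type w₂} [EnrichedCategory C D'] [Tensored C D']

/-- The tensorial strength `z ⊛ β X ⟶ β (z ⊛ X)` of a `C`-functor `β`: the composite of
`z ⊛ β X ⟶ D(X, z ⊛ X) ⊛ β X ⟶ D'(β X, β (z ⊛ X)) ⊛ β X ⟶ β (z ⊛ X)` given by the unit,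
the action of `β` on Hom objects, and the counit. -/
def strength (β : EnrichedFunctor C D D') (z : C) (X : D) :
    ForgetEnrichment.of C ((Tensored.tensor (C := C) (β.obj X)).obj z) ⟶
      ForgetEnrichment.of C (β.obj ((Tensored.tensor (C := C) X).obj z)) :=
  (Tensored.tensor (C := C) (β.obj X)).forget.map ((Tensored.adj (C := C) X).unit.appHom z) ≫
    (Tensored.tensor (C := C) (β.obj X)).forget.map
      (toUnderlying (β.map X ((Tensored.tensor (C := C) X).obj z))) ≫
    (Tensored.adj (C := C) (β.obj X)).counit.appHom (β.obj ((Tensored.tensor (C := C) X).obj z))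

/-- A `C`-functor preserves `C`-tensors if all its tensorial strengths are isomorphisms. -/
def PreservesTensors (β : EnrichedFunctor C D D') : Prop :=
  ∀ (z : C) (X : D), IsIso (strength β z X)

end Strength

section SelfEnrichment

variable [MonoidalClosed C]

variable {C} in
lemma curry'_tensor_comp {P x y z : C} (f : x ⟶ y) (g : P ⟶ (ihom y).obj z) :
    (λ_ P).inv ≫ (MonoidalClosed.curry' f ⊗ₘ g) ≫ MonoidalClosed.comp x y z =
      g ≫ (MonoidalClosed.pre f).app z := by
  rw [tensorHom_def', Category.assoc, MonoidalClosed.curry'_whiskerRight_comp,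
    leftUnitor_naturality_assoc, Iso.inv_hom_id_assoc]

variable {C} in
lemma tensor_curry'_comp {P x y z : C} (g : P ⟶ (ihom x).obj y) (f : y ⟶ z) :
    (ρ_ P).inv ≫ (g ⊗ₘ MonoidalClosed.curry' f) ≫ MonoidalClosed.comp x y z =
      g ≫ (ihom x).map f := by
  rw [MonoidalCategory.tensorHom_def, Category.assoc, MonoidalClosed.whiskerLeft_curry'_comp,
    rightUnitor_naturality_assoc, Iso.inv_hom_id_assoc]

variable {C} in
lemma pre_eq_map {P x x' z z' : C} (f : x ⟶ x') (g : z ⟶ z') (G : P ⟶ (ihom x').obj z')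
    (F : P ⟶ (ihom x).obj z)
    (h : f ▷ P ≫ MonoidalClosed.uncurry G = MonoidalClosed.uncurry F ≫ g) :
    G ≫ (MonoidalClosed.pre f).app z' = F ≫ (ihom x).map g := by
  apply MonoidalClosed.uncurry_injective
  rw [MonoidalClosed.uncurry_pre_app, h, MonoidalClosed.uncurry_natural_right]

variable {C} in
/-- A `C`-natural transformation between functors into `C`, from morphisms of `C`. -/
def transOfHom {A : Type w₁} [EnrichedCategory C A] {F G : EnrichedFunctor C A C}
    (a : ∀ X, F.obj X ⟶ G.obj X)
    (h : ∀ X Y, a X ▷ _ ≫ MonoidalClosed.uncurry (G.map X Y) =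
      MonoidalClosed.uncurry (F.map X Y) ≫ a Y) : EnrichedTrans F G where
  app X := MonoidalClosed.curry' (a X)
  naturality X Y :=
    (curry'_tensor_comp (a X) (G.map X Y)).trans
      ((pre_eq_map (a X) (a Y) (G.map X Y) (F.map X Y) (h X Y)).trans
        (tensor_curry'_comp (F.map X Y) (a Y)).symm)

variable {C} in
lemma toUnderlying_comp {x y z : C} (f : x ⟶ y) (g : y ⟶ z) :
    toUnderlying f ≫ toUnderlying g = toUnderlying (f ≫ g) :=
  (ForgetEnrichment.homOf_comp C (C := C) (X := x) (Y := y) (Z := z) (MonoidalClosed.curry' f)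
    (MonoidalClosed.curry' g)).symm.trans
    (congrArg (ForgetEnrichment.homOf C) (MonoidalClosed.curry'_comp f g).symm)

variable {C} in
lemma toUnderlying_id (x : C) : toUnderlying (𝟙 x) = 𝟙 (ForgetEnrichment.of C x) := by
  rw [toUnderlying, MonoidalClosed.curry'_id]
  exact ForgetEnrichment.homOf_eId C x

variable {C} in
lemma curry'_curry_comp (y : C) {x z : C} (f : x ⟶ z) :
    MonoidalClosed.curry' f ≫ MonoidalClosed.curry (MonoidalClosed.comp y x z) =
      MonoidalClosed.curry' ((ihom y).map f) := by
  rw [← MonoidalClosed.curry_natural_left, MonoidalClosed.whiskerLeft_curry'_comp,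
    MonoidalClosed.curry']

variable {C} in
lemma homFunctor_forget_map (y : C) {x z : C} (f : x ⟶ z) :
    (homFunctor C y).forget.map (toUnderlying f) = toUnderlying ((ihom y).map f) :=
  congrArg (ForgetEnrichment.homOf C) (curry'_curry_comp y f)

end SelfEnrichment

/-! ### `C` is tensored over itself, with `z ⊛ y = z ⊗ y` -/

section SelfTensored

variable [SymmetricCategory C]

variable {C} in
/-- The canonical isomorphism `(x ⊗ y) ⊗ t ⟶ (x ⊗ t) ⊗ y`. -/
def swapRight (x y t : C) : (x ⊗ y) ⊗ t ⟶ (x ⊗ t) ⊗ y :=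
  (α_ x y t).hom ≫ x ◁ (β_ y t).hom ≫ (α_ x t y).inv

variable {C} in
lemma swapRight_natural (x y : C) {s t : C} (f : s ⟶ t) :
    (x ⊗ y) ◁ f ≫ swapRight x y t = swapRight x y s ≫ (x ◁ f) ▷ y := by
  simp only [swapRight, Category.assoc, tensor_whiskerLeft,
    Iso.inv_hom_id_assoc, whisker_assoc]
  rw [← MonoidalCategory.whiskerLeft_comp_assoc, BraidedCategory.braiding_naturality_right,
    MonoidalCategory.whiskerLeft_comp_assoc]

variable {C} in
lemma swapRight_natural_assoc (x y : C) {s t w : C} (f : s ⟶ t) (h : (x ⊗ t) ⊗ y ⟶ w) :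
    (x ⊗ y) ◁ f ≫ swapRight x y t ≫ h = swapRight x y s ≫ (x ◁ f) ▷ y ≫ h := by
  rw [← Category.assoc, swapRight_natural, Category.assoc]

variable {C} in
lemma swapRight_natural_left {x x' : C} (f : x ⟶ x') (y t : C) :
    (f ▷ y) ▷ t ≫ swapRight x' y t = swapRight x y t ≫ (f ▷ t) ▷ y := by
  simp only [swapRight, Category.assoc]
  rw [associator_naturality_left_assoc, ← whisker_exchange_assoc, associator_inv_naturality_left]

variable {C} in
lemma swapRight_natural_left_assoc {x x' w : C} (f : x ⟶ x') (y t : C)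
    (h : (x' ⊗ t) ⊗ y ⟶ w) :
    (f ▷ y) ▷ t ≫ swapRight x' y t ≫ h = swapRight x y t ≫ (f ▷ t) ▷ y ≫ h := by
  rw [← Category.assoc, swapRight_natural_left, Category.assoc]

variable {C} in
lemma swapRight_unit (x y : C) :
    swapRight x y (𝟙_ C) ≫ (ρ_ x).hom ▷ y = (ρ_ (x ⊗ y)).hom := by
  simp [swapRight]

variable {C} in
lemma swapRight_tensor (x y s t : C) :
    swapRight x y (s ⊗ t) = (α_ (x ⊗ y) s t).inv ≫ swapRight x y s ▷ t ≫
      swapRight (x ⊗ s) y t ≫ (α_ x s t).hom ▷ y := by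
  simp [swapRight]

variable [MonoidalClosed C]

/-- The action of `- ⊗ y` on Hom objects. -/
def tensorRightMap (x z y : C) : (ihom x).obj z ⟶ (ihom (x ⊗ y)).obj (z ⊗ y) :=
  MonoidalClosed.curry (swapRight x y ((ihom x).obj z) ≫ (ihom.ev x).app z ▷ y)

variable {C} in
lemma uncurry_tensorRightMap {P x z : C} (g : P ⟶ (ihom x).obj z) (y : C) :
    MonoidalClosed.uncurry (g ≫ tensorRightMap C x z y) =
      swapRight x y P ≫ MonoidalClosed.uncurry g ▷ y := by
  rw [MonoidalClosed.uncurry_natural_left, tensorRightMap, MonoidalClosed.uncurry_curry,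
    swapRight_natural_assoc, ← comp_whiskerRight, ← MonoidalClosed.uncurry_eq]

/-- The `C`-enriched functor `- ⊗ y : C ⥤ C`. -/
def tensorRightFunctor (y : C) : EnrichedFunctor C C C where
  obj x := x ⊗ y
  map x z := tensorRightMap C x z y
  map_id x := by
    apply MonoidalClosed.uncurry_injective
    refine (uncurry_tensorRightMap (MonoidalClosed.id x) y).trans ?_
    refine Eq.trans ?_ (MonoidalClosed.uncurry_curry _).symm
    rw [MonoidalClosed.id_eq, MonoidalClosed.uncurry_curry, swapRight_unit]
  map_comp x z w := by
    apply MonoidalClosed.uncurry_injective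
    refine (uncurry_tensorRightMap (MonoidalClosed.comp x z w) y).trans ?_
    refine Eq.trans ?_ (uncurry_tensor_comp _ _).symm
    have h (x z : C) : MonoidalClosed.uncurry (tensorRightMap C x z y) =
        swapRight x y _ ≫ (ihom.ev x).app z ▷ y := MonoidalClosed.uncurry_curry _
    rw [h, h, MonoidalClosed.comp_eq, MonoidalClosed.uncurry_curry,
      MonoidalClosed.compTranspose_eq, swapRight_tensor]
    simp only [comp_whiskerRight, Category.assoc]
    rw [hom_inv_whiskerRight_assoc]
    exact congrArg (fun k => _ ≫ _ ≫ k) (swapRight_natural_left_assoc _ _ _ _).symm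

variable {C} in
lemma curry'_tensorRightMap {x z : C} (f : x ⟶ z) (y : C) :
    MonoidalClosed.curry' f ≫ tensorRightMap C x z y = MonoidalClosed.curry' (f ▷ y) := by
  apply MonoidalClosed.uncurry_injective
  rw [uncurry_tensorRightMap, MonoidalClosed.curry', MonoidalClosed.curry',
    MonoidalClosed.uncurry_curry, MonoidalClosed.uncurry_curry, comp_whiskerRight,
    ← Category.assoc, swapRight_unit]

variable {C} in
lemma tensorRightFunctor_forget_map {x z : C} (f : x ⟶ z) (y : C) :
    (tensorRightFunctor C y).forget.map (toUnderlying f) = toUnderlying (f ▷ y) :=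
  congrArg (ForgetEnrichment.homOf C) (curry'_tensorRightMap f y)

variable {C} in
lemma selfUnit_natural (y x z : C) :
    MonoidalClosed.curry (β_ y x).hom ▷ (ihom x).obj z ≫
      MonoidalClosed.uncurry (tensorRightMap C x z y ≫
        MonoidalClosed.curry (MonoidalClosed.comp y (x ⊗ y) (z ⊗ y))) =
      MonoidalClosed.uncurry (𝟙 ((ihom x).obj z)) ≫ MonoidalClosed.curry (β_ y z).hom := by
  apply MonoidalClosed.uncurry_injective
  rw [MonoidalClosed.uncurry_natural_left (tensorRightMap C x z y), MonoidalClosed.uncurry_curry,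
    ← Category.assoc (MonoidalClosed.curry (β_ y x).hom ▷ (ihom x).obj z),
    ← MonoidalCategory.tensorHom_def, uncurry_tensor_comp, MonoidalClosed.uncurry_curry,
    tensorRightMap, MonoidalClosed.uncurry_curry,
    MonoidalClosed.uncurry_natural_left, MonoidalClosed.uncurry_curry,
    MonoidalClosed.uncurry_id_eq_ev, BraidedCategory.braiding_naturality_right,
    BraidedCategory.braiding_tensor_right_hom, swapRight]
  simp

variable {C} in
/-- Evaluation `[y, z] ⊗ y ⟶ z`. -/
def evalRight (y z : C) : (ihom y).obj z ⊗ y ⟶ z :=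
  (β_ ((ihom y).obj z) y).hom ≫ MonoidalClosed.uncurry (𝟙 ((ihom y).obj z))

variable {C} in
lemma whiskerRight_evalRight {x y z : C} (f : x ⟶ (ihom y).obj z) :
    f ▷ y ≫ evalRight y z = (β_ x y).hom ≫ MonoidalClosed.uncurry f := by
  rw [evalRight, BraidedCategory.braiding_naturality_left_assoc,
    ← MonoidalClosed.uncurry_natural_left, Category.comp_id]

variable {C} in
lemma selfCounit_natural (y z w : C) :
    evalRight y z ▷ (ihom z).obj w ≫ MonoidalClosed.uncurry (𝟙 ((ihom z).obj w)) =
    MonoidalClosed.uncurry (MonoidalClosed.curry (MonoidalClosed.comp y z w) ≫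
      tensorRightMap C ((ihom y).obj z) ((ihom y).obj w) y) ≫ evalRight y w := by
  rw [uncurry_tensorRightMap, MonoidalClosed.uncurry_curry, Category.assoc,
    whiskerRight_evalRight,
    MonoidalClosed.comp_eq, MonoidalClosed.uncurry_curry, MonoidalClosed.compTranspose_eq,
    ← MonoidalClosed.uncurry_id_eq_ev, ← MonoidalClosed.uncurry_id_eq_ev,
    BraidedCategory.braiding_tensor_left_hom, swapRight, evalRight]
  simp [← MonoidalCategory.whiskerLeft_comp_assoc]

variable {C} in
lemma self_left_triangle (x y : C) :
    MonoidalClosed.curry (β_ y x).hom ▷ y ≫ evalRight y (x ⊗ y) = 𝟙 (x ⊗ y) := by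
  rw [whiskerRight_evalRight, MonoidalClosed.uncurry_curry, SymmetricCategory.symmetry]

variable {C} in
lemma self_right_triangle (y z : C) :
    MonoidalClosed.curry (β_ y ((ihom y).obj z)).hom ≫ (ihom y).map (evalRight y z) =
      𝟙 ((ihom y).obj z) := by
  rw [← MonoidalClosed.curry_natural_right, evalRight, SymmetricCategory.symmetry_assoc,
    MonoidalClosed.curry_uncurry]

/-- The adjunction between `- ⊗ y` and the internal Hom functor. -/
def selfAdj (y : C) : EnrichedAdjunction (tensorRightFunctor C y) (homFunctor C y) where
  unit := transOfHom (fun x => MonoidalClosed.curry (β_ y x).hom) (selfUnit_natural y)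
  counit := transOfHom (fun z => evalRight y z) (selfCounit_natural y)
  left_triangle x :=
    (congrArg (· ≫ _) (tensorRightFunctor_forget_map _ _)).trans
      ((toUnderlying_comp _ _).trans
        ((congrArg toUnderlying (self_left_triangle x y)).trans (toUnderlying_id _)))
  right_triangle z :=
    (congrArg (_ ≫ ·) (homFunctor_forget_map _ _)).trans
      ((toUnderlying_comp _ _).trans
        ((congrArg toUnderlying (self_right_triangle y z)).trans (toUnderlying_id _)))

/-- The self-enriched category `C` is tensored. -/
instance selfTensored : Tensored C C where
  tensor y := tensorRightFunctor C y
  adj y := selfAdj C y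

end SelfTensored

/-! ### Compact generators and endomorphism monoids -/

section CompactGenerator

variable [SymmetricCategory C] [MonoidalClosed C]
variable {D : Type w₁} [EnrichedCategory C D]

/-- A `C`-enriched compact object: `D(X, -)` preserves `C`-tensors, and its underlying functor
preserves coequalizers. -/
structure IsCompactObject [Tensored C D] (X : D) : Prop where
  preservesTensors : PreservesTensors (homFunctor C X)
  preservesCoequalizers : PreservesCoequalizers (homFunctor C X)

/-- A `C`-enriched generator: `D(X, -)` is conservative. -/
def IsGenerator (X : D) : Prop :=
  IsConservative (homFunctor C X)

/-- A `C`-enriched compact generator. -/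
structure IsCompactGenerator [Tensored C D] (X : D) : Prop where
  isCompactObject : IsCompactObject C X
  isGenerator : IsGenerator C X

/-- The endomorphism monoid of `X`.  Its multiplication is `g ⊗ f ↦ g ∘ f`; since `eComp` takes
the morphism applied first as its first argument, the symmetry is applied before it. -/
def endMonoid (X : D) : Mon C :=
  letI : MonObj (EnrichedCategory.Hom (V := C) X X) :=
    { one := eId C X
      mul := (β_ (EnrichedCategory.Hom X X) (EnrichedCategory.Hom X X)).hom ≫ eComp C X X X
      one_mul := by
        rw [BraidedCategory.braiding_naturality_left_assoc, (Iso.inv_comp_eq _).1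
          (e_comp_id C X X), Category.comp_id, braiding_rightUnitor]
      mul_one := by
        rw [BraidedCategory.braiding_naturality_right_assoc, (Iso.inv_comp_eq _).1
          (e_id_comp C X X), Category.comp_id, braiding_leftUnitor]
      mul_assoc := by
        simp only [comp_whiskerRight, MonoidalCategory.whiskerLeft_comp, Category.assoc]
        rw [BraidedCategory.braiding_naturality_left_assoc, ← e_assoc,
          BraidedCategory.braiding_naturality_right_assoc,
          BraidedCategory.braiding_tensor_left_hom, BraidedCategory.braiding_tensor_right_hom]
        simp only [Category.assoc, Iso.hom_inv_id_assoc]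
        rw [← BraidedCategory.yang_baxter_assoc]
        simp [e_assoc'] }
  ⟨EnrichedCategory.Hom X X⟩

end CompactGenerator

/-! ### The enriched category of right modules -/

section RightModules

variable {C}

/-- A right module over a monoid `b`. -/
structure RightMod (b : Mon C) where
  /-- The underlying object. -/
  obj : C
  /-- The right action. -/
  act : obj ⊗ b.X ⟶ obj
  act_one : obj ◁ MonObj.one ≫ act = (ρ_ obj).hom
  act_mul : obj ◁ MonObj.mul ≫ act = (α_ obj b.X b.X).inv ≫ act ▷ b.X ≫ act

variable [SymmetricCategory C] [MonoidalClosed C] {b : Mon C}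

namespace RightMod

/-- Precomposition with the action: `[z, z'] ⟶ [z ⊗ b, z']`. -/
def preAct (M N : RightMod b) : (ihom M.obj).obj N.obj ⟶ (ihom (M.obj ⊗ b.X)).obj N.obj :=
  (MonoidalClosed.pre M.act).app N.obj

/-- `- ⊗ b` followed by the action: `[z, z'] ⟶ [z ⊗ b, z' ⊗ b] ⟶ [z ⊗ b, z']`. -/
def postAct (M N : RightMod b) : (ihom M.obj).obj N.obj ⟶ (ihom (M.obj ⊗ b.X)).obj N.obj :=
  (tensorRightFunctor C b.X).map M.obj N.obj ≫ (ihom (M.obj ⊗ b.X)).map N.act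

lemma equalizes_iff {M N : RightMod b} {P : C} (p : P ⟶ (ihom M.obj).obj N.obj) :
    p ≫ preAct M N = p ≫ postAct M N ↔
      M.act ▷ P ≫ MonoidalClosed.uncurry p =
        swapRight M.obj b.X P ≫ MonoidalClosed.uncurry p ▷ b.X ≫ N.act := by
  have h1 : MonoidalClosed.uncurry (p ≫ preAct M N) = M.act ▷ P ≫ MonoidalClosed.uncurry p :=
    MonoidalClosed.uncurry_pre_app (X := N.obj) p M.act
  have h2 : MonoidalClosed.uncurry (p ≫ postAct M N) =
      swapRight M.obj b.X P ≫ MonoidalClosed.uncurry p ▷ b.X ≫ N.act := by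
    rw [← Category.assoc, ← uncurry_tensorRightMap, ← MonoidalClosed.uncurry_natural_right,
      Category.assoc]
    rfl
  rw [← h1, ← h2, MonoidalClosed.uncurry_injective.eq_iff]

lemma id_equalizes (M : RightMod b) :
    MonoidalClosed.id M.obj ≫ preAct M M = MonoidalClosed.id M.obj ≫ postAct M M := by
  rw [equalizes_iff, MonoidalClosed.id_eq, MonoidalClosed.uncurry_curry,
    ← Category.assoc (swapRight _ _ _), swapRight_unit, rightUnitor_naturality]

variable [HasFiniteLimits C]

/-- The Hom object of right modules, an equalizer. -/
def homObj (M N : RightMod b) : C := equalizer (preAct M N) (postAct M N)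

/-- The inclusion of the Hom object of modules in the internal Hom. -/
def homι (M N : RightMod b) : homObj M N ⟶ (ihom M.obj).obj N.obj :=
  equalizer.ι (preAct M N) (postAct M N)

instance (M N : RightMod b) : Mono (homι M N) := by
  exact equalizer.ι_mono

lemma homι_condition (M N : RightMod b) :
    M.act ▷ _ ≫ MonoidalClosed.uncurry (homι M N) =
      swapRight M.obj b.X _ ≫ MonoidalClosed.uncurry (homι M N) ▷ b.X ≫ N.act :=
  (equalizes_iff _).1 (equalizer.condition _ _)

lemma comp_equalizes (L M N : RightMod b) :
    ((homι L M ⊗ₘ homι M N) ≫ MonoidalClosed.comp L.obj M.obj N.obj) ≫ preAct L N =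
      ((homι L M ⊗ₘ homι M N) ≫ MonoidalClosed.comp L.obj M.obj N.obj) ≫ postAct L N := by
  rw [equalizes_iff, uncurry_tensor_comp, swapRight_tensor]
  simp only [comp_whiskerRight, Category.assoc]
  rw [hom_inv_whiskerRight_assoc, ← swapRight_natural_left_assoc, ← homι_condition,
    ← comp_whiskerRight_assoc, ← comp_whiskerRight_assoc, Category.assoc, ← homι_condition,
    comp_whiskerRight_assoc, associator_inv_naturality_left_assoc]

/-- The identity of a right module, as a morphism into its Hom object. -/
def homId (M : RightMod b) : 𝟙_ C ⟶ homObj M M :=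
  equalizer.lift (MonoidalClosed.id M.obj) (id_equalizes M)

/-- Composition of the Hom objects of right modules. -/
def homComp (L M N : RightMod b) : homObj L M ⊗ homObj M N ⟶ homObj L N :=
  equalizer.lift ((homι L M ⊗ₘ homι M N) ≫ MonoidalClosed.comp L.obj M.obj N.obj)
    (comp_equalizes L M N)

lemma homId_ι (M : RightMod b) : homId M ≫ homι M M = MonoidalClosed.id M.obj :=
  equalizer.lift_ι _ _

lemma homComp_ι (L M N : RightMod b) : homComp L M N ≫ homι L N =
    (homι L M ⊗ₘ homι M N) ≫ MonoidalClosed.comp L.obj M.obj N.obj :=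
  equalizer.lift_ι _ _

/-- The `C`-enriched category of right modules over `b`. -/
instance : EnrichedCategory C (RightMod b) where
  Hom := homObj
  id := homId
  comp := homComp
  id_comp M N := by
    rw [← cancel_mono (homι M N), Category.assoc, Category.assoc, homComp_ι,
      ← tensorHom_id, tensorHom_comp_tensorHom_assoc, homId_ι, ← MonoidalClosed.curry'_id,
      curry'_tensor_comp, MonoidalClosed.pre_id]
    exact Category.comp_id _
  comp_id M N := by
    rw [← cancel_mono (homι M N), Category.assoc, Category.assoc, homComp_ι,
      ← id_tensorHom, tensorHom_comp_tensorHom_assoc, homId_ι, ← MonoidalClosed.curry'_id,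
      tensor_curry'_comp, CategoryTheory.Functor.map_id]
    exact Category.comp_id _
  assoc K L M N := by
    rw [← cancel_mono (homι K N)]
    simp only [Category.assoc, homComp_ι]
    rw [← tensorHom_id, ← id_tensorHom, tensorHom_comp_tensorHom_assoc,
      tensorHom_comp_tensorHom_assoc, homComp_ι, homComp_ι, Category.id_comp, Category.id_comp]
    have h1 : ((homι K L ⊗ₘ homι L M) ≫ MonoidalClosed.comp K.obj L.obj M.obj ⊗ₘ homι M N) =
        ((homι K L ⊗ₘ homι L M) ⊗ₘ homι M N) ≫
          MonoidalClosed.comp K.obj L.obj M.obj ▷ (ihom M.obj).obj N.obj := by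
      rw [← tensorHom_id, tensorHom_comp_tensorHom, Category.comp_id]
    have h2 : (homι K L ⊗ₘ (homι L M ⊗ₘ homι M N) ≫ MonoidalClosed.comp L.obj M.obj N.obj) =
        (homι K L ⊗ₘ homι L M ⊗ₘ homι M N) ≫
          (ihom K.obj).obj L.obj ◁ MonoidalClosed.comp L.obj M.obj N.obj := by
      rw [← id_tensorHom, tensorHom_comp_tensorHom, Category.comp_id]
    rw [h1, h2, Category.assoc, Category.assoc, ← associator_inv_naturality_assoc,
      MonoidalClosed.assoc]

end RightMod

end RightModules

end Closed
end EnrichedMorita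
end

/-!
Morita theory over a closed symmetric monoidal category `C`.

*A compact generator gives an equivalence.* Let `X` be a compact generator of `D` and let
`φ : b ⟶ D(X, X)` be an isomorphism of monoids. Composition makes `D(X, Y)` a right `b`-module
(`homModule`), and the comparison functor `Y ↦ D(X, Y)` (`homModuleFunctor`) is shown to be
essentially surjective and fully faithful, hence an equivalence (`equivalenceOfFullyFaithful`).

* Essential surjectivity is `exists_represents`. Preservation of tensors says that the free module
  `z ⊗ b ≅ z ⊗ D(X, X)` is `D(X, z ⊛ X)`. Every module `M` is the coequalizer of
  `(M ⊗ b) ⊗ b ⇉ M ⊗ b`; both morphisms are linear, so they come from morphisms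
  `(M ⊗ b) ⊛ X ⇉ M ⊛ X` of `D`. As `D(X, -)` preserves the coequalizer `Q` of these,
  `D(X, Q) ≅ M`. By construction morphisms `Q ⟶ W` correspond to linear morphisms
  `M ⟶ D(X, W)`.
* The underlying functor is fully faithful (`existsUnique_post_eq`): for `M = D(X, Y)` the identity
  corresponds to a morphism `Q ⟶ Y`, which becomes invertible after applying `D(X, -)`, and is
  therefore invertible by conservativity. So morphisms `Y ⟶ W` correspond to linear morphisms
  `D(X, Y) ⟶ D(X, W)`.
* Full faithfulness on Hom objects (`isIso_homModuleMap`) follows by the Yoneda lemma in `C`: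
  morphisms `z ⟶ D(Y, W)` are morphisms `z ⊛ Y ⟶ W`, and the strength
  `z ⊗ D(X, Y) ≅ D(X, z ⊛ Y)` matches these with morphisms from `z` into the Hom object of modules.

*An equivalence gives a compact generator.* The regular module `b` represents the forgetful functor
from modules to `C` (`RightMod.freeIso`). That functor reflects isomorphisms, and it preserves
coequalizers because `- ⊗ b` does. Up to `RightMod.freeIso`, the strength of the regular module is
the canonical morphism `z ⊗ M ⟶ z ⊛ M`, which is invertible because `z ⊗ M` is a tensor
(`RightMod.isIso_homStrength_regular`). The endomorphism monoid of `b` is `b`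
(`endMonoidRegularIso`). All of this transports along an equivalence
(`EnrichedEquivalence.exists_isCompactGenerator`), whose functors are fully faithful and preserve
tensors.

Throughout, a morphism of an enriched category is handled as an element `𝟙_ C ⟶ D(X, Y)` of a Hom
object, acting on Hom objects by `post` and `pre`.
-/

noncomputable section

namespace EnrichedMorita

/-! ### Composition with elements of Hom objects -/

section Whisker

variable {V : Type u} [Category.{v} V] [MonoidalCategory V]
variable {A : Type w₁} [EnrichedCategory V A] {B : Type w₂} [EnrichedCategory V B]

/-- Postcomposition `A(X, Y) ⟶ A(X, Z)` with an element of `A(Y, Z)`. -/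
def post (X : A) {Y Z : A} (f : 𝟙_ V ⟶ (Y ⟶[V] Z)) : (X ⟶[V] Y) ⟶ (X ⟶[V] Z) :=
  (ρ_ _).inv ≫ _ ◁ f ≫ eComp V X Y Z

/-- Precomposition `A(Y, Z) ⟶ A(X, Z)` with an element of `A(X, Y)`. -/
def pre {X Y : A} (f : 𝟙_ V ⟶ (X ⟶[V] Y)) (Z : A) : (Y ⟶[V] Z) ⟶ (X ⟶[V] Z) :=
  (λ_ _).inv ≫ f ▷ _ ≫ eComp V X Y Z

@[simp]
lemma post_eId (X Y : A) : post X (eId V Y) = 𝟙 (X ⟶[V] Y) :=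
  e_comp_id V X Y

@[simp]
lemma pre_eId (X Y : A) : pre (eId V X) Y = 𝟙 (X ⟶[V] Y) :=
  e_id_comp V X Y

lemma eComp_post (X Y : A) {Z W : A} (f : 𝟙_ V ⟶ (Z ⟶[V] W)) :
    eComp V X Y Z ≫ post X f = _ ◁ post Y f ≫ eComp V X Y W :=
  eComp_eHomWhiskerLeft V (C := ForgetEnrichment V A) X Y f

lemma eComp_pre {X Y : A} (f : 𝟙_ V ⟶ (X ⟶[V] Y)) (Z W : A) :
    eComp V Y Z W ≫ pre f W = pre f Z ▷ _ ≫ eComp V X Z W :=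
  eComp_eHomWhiskerRight V (C := ForgetEnrichment V A) f Z W

/-- Precomposition and postcomposition commute. -/
lemma post_pre {X Y Z W : A} (f : 𝟙_ V ⟶ (X ⟶[V] Y)) (g : 𝟙_ V ⟶ (Z ⟶[V] W)) :
    post Y g ≫ pre f W = pre f Z ≫ post X g :=
  eHom_whisker_exchange V (C := ForgetEnrichment V A) f g

/-- Composition is balanced: `g ∘ (f ∘ h) = (g ∘ f) ∘ h` for an element `f` in the middle. -/
lemma post_eComp (X : A) {Y Z : A} (f : 𝟙_ V ⟶ (Y ⟶[V] Z)) (W : A) :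
    post X f ▷ (Z ⟶[V] W) ≫ eComp V X Z W = (X ⟶[V] Y) ◁ pre f W ≫ eComp V X Y W := by
  simp only [post, pre, comp_whiskerRight, MonoidalCategory.whiskerLeft_comp, Category.assoc]
  rw [← e_assoc', associator_naturality_middle_assoc]
  simp

lemma element_post {X Y Z : A} (f : 𝟙_ V ⟶ (X ⟶[V] Y)) (g : 𝟙_ V ⟶ (Y ⟶[V] Z)) :
    f ≫ post X g = (λ_ _).inv ≫ (f ⊗ₘ g) ≫ eComp V X Y Z := by
  rw [post, rightUnitor_inv_naturality_assoc, MonoidalCategory.tensorHom_def, unitors_inv_equal,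
    Category.assoc]

lemma post_eq_pre {X Y Z : A} (f : 𝟙_ V ⟶ (X ⟶[V] Y)) (g : 𝟙_ V ⟶ (Y ⟶[V] Z)) :
    f ≫ post X g = g ≫ pre f Z := by
  rw [element_post, pre, leftUnitor_inv_naturality_assoc, MonoidalCategory.tensorHom_def',
    Category.assoc]

lemma post_comp (X : A) {Y Z W : A} (f : 𝟙_ V ⟶ (Y ⟶[V] Z)) (g : 𝟙_ V ⟶ (Z ⟶[V] W)) :
    post X (f ≫ post Y g) = post X f ≫ post X g := by
  rw [post, MonoidalCategory.whiskerLeft_comp_assoc, ← eComp_post,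
    ← Category.assoc, ← Category.assoc, Category.assoc (ρ_ _).inv]
  rfl

lemma pre_comp {X Y Z : A} (f : 𝟙_ V ⟶ (X ⟶[V] Y)) (g : 𝟙_ V ⟶ (Y ⟶[V] Z)) (W : A) :
    pre (f ≫ post X g) W = pre g W ≫ pre f W := by
  rw [post_eq_pre, pre, comp_whiskerRight_assoc, ← eComp_pre, ← Category.assoc, ← Category.assoc,
    Category.assoc (λ_ _).inv]
  rfl

@[simp]
lemma eId_post {X Y : A} (f : 𝟙_ V ⟶ (X ⟶[V] Y)) : eId V X ≫ post X f = f := by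
  rw [post_eq_pre, pre_eId, Category.comp_id]

lemma map_post (F : EnrichedFunctor V A B) (X : A) {Y Z : A} (f : 𝟙_ V ⟶ (Y ⟶[V] Z)) :
    post X f ≫ F.map X Z = F.map X Y ≫ post (F.obj X) (f ≫ F.map Y Z) := by
  simp only [post, Category.assoc, F.map_comp]
  rw [MonoidalCategory.tensorHom_def', rightUnitor_inv_naturality_assoc]
  simp only [← whisker_exchange_assoc, Category.assoc, MonoidalCategory.whiskerLeft_comp]

lemma map_pre (F : EnrichedFunctor V A B) {X Y : A} (f : 𝟙_ V ⟶ (X ⟶[V] Y)) (Z : A) :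
    pre f Z ≫ F.map X Z = F.map Y Z ≫ pre (f ≫ F.map X Y) (F.obj Z) := by
  simp only [pre, Category.assoc, F.map_comp]
  rw [MonoidalCategory.tensorHom_def, leftUnitor_inv_naturality_assoc]
  simp only [whisker_exchange_assoc, Category.assoc, comp_whiskerRight]

/-- The elements `f` and `g` are mutually inverse. -/
structure AreInverse {X Y : A} (f : 𝟙_ V ⟶ (X ⟶[V] Y)) (g : 𝟙_ V ⟶ (Y ⟶[V] X)) : Prop where
  hom_inv : f ≫ post X g = eId V X
  inv_hom : g ≫ post Y f = eId V Y

namespace AreInverse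

variable {X Y : A} {f : 𝟙_ V ⟶ (X ⟶[V] Y)} {g : 𝟙_ V ⟶ (Y ⟶[V] X)}

lemma symm (h : AreInverse f g) : AreInverse g f := ⟨h.inv_hom, h.hom_inv⟩

/-- Postcomposition with an invertible element. -/
@[simps]
def postIso (h : AreInverse f g) (Z : A) : (Z ⟶[V] X) ≅ (Z ⟶[V] Y) where
  hom := post Z f
  inv := post Z g
  hom_inv_id := by rw [← post_comp, h.hom_inv, post_eId]
  inv_hom_id := by rw [← post_comp, h.inv_hom, post_eId]

/-- Precomposition with an invertible element. -/
@[simps]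
def preIso (h : AreInverse f g) (Z : A) : (Y ⟶[V] Z) ≅ (X ⟶[V] Z) where
  hom := pre f Z
  inv := pre g Z
  hom_inv_id := by rw [← pre_comp, h.inv_hom, pre_eId]
  inv_hom_id := by rw [← pre_comp, h.hom_inv, pre_eId]

end AreInverse

lemma homOf_post {X Y Z : A} (f : 𝟙_ V ⟶ (X ⟶[V] Y)) (g : 𝟙_ V ⟶ (Y ⟶[V] Z)) :
    ForgetEnrichment.homOf V (f ≫ post X g) =
      ForgetEnrichment.homOf V f ≫ ForgetEnrichment.homOf V g := by
  rw [element_post, ForgetEnrichment.homOf_comp]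

lemma homTo_comp_eq_post {X Y Z : ForgetEnrichment V A} (f : X ⟶ Y) (g : Y ⟶ Z) :
    ForgetEnrichment.homTo V (f ≫ g) =
      ForgetEnrichment.homTo V f ≫ post (A := A) X (ForgetEnrichment.homTo V g) :=
  (homOf_post (A := A) (X := X) (Y := Y) (Z := Z) (ForgetEnrichment.homTo V f)
    (ForgetEnrichment.homTo V g)).symm

/-- Injectivity holds by definition; the lemma moves equations between elements to the underlying
category, where composition of morphisms is available. -/
lemma homTo_injective {X Y : ForgetEnrichment V A} {f g : X ⟶ Y}
    (h : ForgetEnrichment.homTo V f = ForgetEnrichment.homTo V g) : f = g := h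

lemma AreInverse.isIso {X Y : A} {f : 𝟙_ V ⟶ (X ⟶[V] Y)} {g : 𝟙_ V ⟶ (Y ⟶[V] X)}
    (h : AreInverse f g) : IsIso (ForgetEnrichment.homOf V f) :=
  ⟨ForgetEnrichment.homOf V g, by rw [← homOf_post, h.hom_inv, ForgetEnrichment.homOf_eId],
    by rw [← homOf_post, h.inv_hom, ForgetEnrichment.homOf_eId]⟩

lemma areInverse_of_iso {X Y : ForgetEnrichment V A} (e : X ≅ Y) :
    AreInverse (A := A) (X := X) (Y := Y) (ForgetEnrichment.homTo V e.hom)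
      (ForgetEnrichment.homTo V e.inv) where
  hom_inv := by rw [← homTo_comp_eq_post, e.hom_inv_id, ForgetEnrichment.homTo_id]; rfl
  inv_hom := by rw [← homTo_comp_eq_post, e.inv_hom_id, ForgetEnrichment.homTo_id]; rfl

/-- `V`-naturality, with the composites with components written as `pre` and `post`. -/
lemma naturality_iff {F G : EnrichedFunctor V A B} (a : ∀ X, 𝟙_ V ⟶ (F.obj X ⟶[V] G.obj X))
    (X Y : A) :
    (λ_ (X ⟶[V] Y)).inv ≫ (a X ⊗ₘ G.map X Y) ≫ eComp V (F.obj X) (G.obj X) (G.obj Y) =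
      (ρ_ (X ⟶[V] Y)).inv ≫ (F.map X Y ⊗ₘ a Y) ≫ eComp V (F.obj X) (F.obj Y) (G.obj Y) ↔
    G.map X Y ≫ pre (a X) (G.obj Y) = F.map X Y ≫ post (F.obj X) (a Y) := by
  rw [MonoidalCategory.tensorHom_def', MonoidalCategory.tensorHom_def, Category.assoc,
    Category.assoc, ← leftUnitor_inv_naturality_assoc, ← rightUnitor_inv_naturality_assoc]
  rfl

lemma EnrichedTrans.map_pre {F G : EnrichedFunctor V A B} (τ : EnrichedTrans F G) (X Y : A) :
    G.map X Y ≫ pre (τ.app X) (G.obj Y) = F.map X Y ≫ post (F.obj X) (τ.app Y) :=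
  (naturality_iff _ X Y).1 (τ.naturality X Y)

lemma EnrichedTrans.element_naturality {F G : EnrichedFunctor V A B} (τ : EnrichedTrans F G)
    {X Y : A} (f : 𝟙_ V ⟶ (X ⟶[V] Y)) :
    (f ≫ F.map X Y) ≫ post (F.obj X) (τ.app Y) =
      τ.app X ≫ post (F.obj X) (f ≫ G.map X Y) := by
  rw [post_eq_pre (τ.app X), Category.assoc, Category.assoc, τ.map_pre]

/-- Pointwise inverse elements which are `V`-natural in one direction form an isomorphism of
`V`-functors. -/
def EnrichedNatIso.ofComponents {F G : EnrichedFunctor V A B}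
    (a : ∀ X, 𝟙_ V ⟶ (F.obj X ⟶[V] G.obj X)) (a' : ∀ X, 𝟙_ V ⟶ (G.obj X ⟶[V] F.obj X))
    (h : ∀ X, AreInverse (a X) (a' X))
    (nat : ∀ X Y, G.map X Y ≫ pre (a X) (G.obj Y) = F.map X Y ≫ post (F.obj X) (a Y)) :
    EnrichedNatIso F G where
  hom := { app := a, naturality := fun X Y => (naturality_iff a X Y).2 (nat X Y) }
  inv :=
    { app := a'
      naturality := fun X Y => (naturality_iff a' X Y).2 <| by
        rw [← cancel_mono ((h Y).postIso _).hom, Category.assoc, Category.assoc]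
        have e1 := ((h Y).postIso (G.obj X)).inv_hom_id
        have e2 := ((h X).preIso (G.obj Y)).hom_inv_id
        simp only [AreInverse.postIso_hom, AreInverse.postIso_inv, AreInverse.preIso_hom,
          AreInverse.preIso_inv] at e1 e2 ⊢
        rw [e1, ← post_pre, ← reassoc_of% nat X Y, e2] }
  hom_inv_id X := by
    refine (homOf_post (a X) (a' X)).symm.trans ?_
    rw [(h X).hom_inv, ForgetEnrichment.homOf_eId]
  inv_hom_id X := by
    refine (homOf_post (a' X) (a X)).symm.trans ?_
    rw [(h X).inv_hom, ForgetEnrichment.homOf_eId]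

lemma EnrichedNatIso.areInverse {F G : EnrichedFunctor V A B} (e : EnrichedNatIso F G) (X : A) :
    AreInverse (e.hom.app X) (e.inv.app X) where
  hom_inv := by
    have h := e.hom_inv_id X
    rw [← ForgetEnrichment.homOf_eId] at h
    exact (homOf_post (e.hom.app X) (e.inv.app X)).trans h
  inv_hom := by
    have h := e.inv_hom_id X
    rw [← ForgetEnrichment.homOf_eId] at h
    exact (homOf_post (e.inv.app X) (e.hom.app X)).trans h

end Whisker

/-! ### Fully faithful and essentially surjective enriched functors -/

section Equivalence

variable {V : Type u} [Category.{v} V] [MonoidalCategory V]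
variable {A : Type w₁} [EnrichedCategory V A] {B : Type w₂} [EnrichedCategory V B]

lemma eId_pre {X Y : A} (f : 𝟙_ V ⟶ (X ⟶[V] Y)) : eId V Y ≫ pre f Y = f := by
  rw [← post_eq_pre, post_eId, Category.comp_id]

/-- A functor which is faithful on Hom objects reflects inverse elements. -/
lemma AreInverse.of_map (F : EnrichedFunctor V A B) [∀ X Y, Mono (F.map X Y)] {X Y : A}
    {f : 𝟙_ V ⟶ (X ⟶[V] Y)} {g : 𝟙_ V ⟶ (Y ⟶[V] X)}
    (h : AreInverse (f ≫ F.map X Y) (g ≫ F.map Y X)) : AreInverse f g where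
  hom_inv := by
    rw [← cancel_mono (F.map X X), Category.assoc, map_post, F.map_id, ← h.hom_inv, Category.assoc]
  inv_hom := by
    rw [← cancel_mono (F.map Y Y), Category.assoc, map_post, F.map_id, ← h.inv_hom, Category.assoc]

lemma AreInverse.post_comp_post {X Y : A} {f : 𝟙_ V ⟶ (X ⟶[V] Y)} {g : 𝟙_ V ⟶ (Y ⟶[V] X)}
    (h : AreInverse f g) (Z : A) : post Z f ≫ post Z g = 𝟙 _ :=
  (h.postIso Z).hom_inv_id

lemma AreInverse.pre_comp_pre {X Y : A} {f : 𝟙_ V ⟶ (X ⟶[V] Y)} {g : 𝟙_ V ⟶ (Y ⟶[V] X)}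
    (h : AreInverse f g) (Z : A) : pre f Z ≫ pre g Z = 𝟙 _ :=
  (h.preIso Z).hom_inv_id

lemma AreInverse.isIso_post {X Y : A} {f : 𝟙_ V ⟶ (X ⟶[V] Y)} {g : 𝟙_ V ⟶ (Y ⟶[V] X)}
    (h : AreInverse f g) (Z : A) : IsIso (post Z f) :=
  (h.postIso Z).isIso_hom

lemma AreInverse.isIso_pre {X Y : A} {f : 𝟙_ V ⟶ (X ⟶[V] Y)} {g : 𝟙_ V ⟶ (Y ⟶[V] X)}
    (h : AreInverse f g) (Z : A) : IsIso (pre f Z) :=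
  (h.preIso Z).isIso_hom

/-- Conjugation by elements at the three objects is compatible with composition; only the element
at the middle object has to be invertible. -/
lemma AreInverse.eComp_conj {X X' Y Y' Z Z' : A} {f : 𝟙_ V ⟶ (X' ⟶[V] X)}
    {g : 𝟙_ V ⟶ (Y' ⟶[V] Y)} {g' : 𝟙_ V ⟶ (Y ⟶[V] Y')} (hg : AreInverse g g')
    {k : 𝟙_ V ⟶ (Z ⟶[V] Z')} :
    (pre f Y ≫ post X' g' ⊗ₘ pre g Z ≫ post Y' k) ≫ eComp V X' Y' Z' =
      eComp V X Y Z ≫ pre f Z ≫ post X' k := by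
  rw [← tensorHom_comp_tensorHom, Category.assoc, MonoidalCategory.tensorHom_def (post X' g'),
    Category.assoc, ← eComp_post, reassoc_of% post_eComp, MonoidalCategory.tensorHom_def,
    Category.assoc, ← MonoidalCategory.whiskerLeft_comp_assoc, hg.pre_comp_pre,
    MonoidalCategory.whiskerLeft_id, Category.id_comp, ← reassoc_of% eComp_pre]

section

variable (F : EnrichedFunctor V A B) [∀ X Y, IsIso (F.map X Y)] (G : B → A)
  {e : ∀ N, 𝟙_ V ⟶ (F.obj (G N) ⟶[V] N)} {e' : ∀ N, 𝟙_ V ⟶ (N ⟶[V] F.obj (G N))}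
  (h : ∀ N, AreInverse (e N) (e' N))

/-- The action on Hom objects of the inverse of a fully faithful `V`-functor `F`: conjugation by
the isomorphisms `F (G N) ≅ N`, followed by the inverse of the action of `F`. -/
def inverseMap (e : ∀ N, 𝟙_ V ⟶ (F.obj (G N) ⟶[V] N)) (e' : ∀ N, 𝟙_ V ⟶ (N ⟶[V] F.obj (G N)))
    (N N' : B) : (N ⟶[V] N') ⟶ (G N ⟶[V] G N') :=
  pre (e N) N' ≫ post (F.obj (G N)) (e' N') ≫ inv (F.map (G N) (G N'))

lemma inverseMap_comp (N N' : B) :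
    inverseMap F G e e' N N' ≫ F.map (G N) (G N') = pre (e N) N' ≫ post (F.obj (G N)) (e' N') := by
  simp [inverseMap]

/-- The inverse of a fully faithful `V`-functor `F`, from a choice of objects `G N` with
isomorphisms `F (G N) ≅ N`. -/
def inverseOfFullyFaithful : EnrichedFunctor V B A where
  obj := G
  map N N' := inverseMap F G e e' N N'
  map_id N := by
    rw [inverseMap, reassoc_of% eId_pre (e N), reassoc_of% (h N).hom_inv, IsIso.comp_inv_eq,
      F.map_id]
  map_comp N N' N'' := by
    rw [← cancel_mono (F.map _ _)]
    simp only [Category.assoc]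
    rw [F.map_comp, tensorHom_comp_tensorHom_assoc, inverseMap_comp, inverseMap_comp,
      inverseMap_comp, ← (h N').eComp_conj]

lemma inverseMap_unit_naturality (X Y : A)
    (hX : AreInverse (e (F.obj X)) (e' (F.obj X))) :
    (F.map X Y ≫ inverseMap F G e e' (F.obj X) (F.obj Y)) ≫
      pre (e' (F.obj X) ≫ inv (F.map X (G (F.obj X)))) (G (F.obj Y)) =
    post X (e' (F.obj Y) ≫ inv (F.map Y (G (F.obj Y)))) := by
  rw [← cancel_mono (F.map X (G (F.obj Y))), Category.assoc, Category.assoc, map_pre, map_post,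
    reassoc_of% inverseMap_comp F G (e := e) (e' := e') (F.obj X) (F.obj Y), Category.assoc,
    Category.assoc, IsIso.inv_hom_id, IsIso.inv_hom_id,
    Category.comp_id, Category.comp_id, post_pre, reassoc_of% hX.pre_comp_pre]

lemma inverseMap_counit_naturality (N N' : B) (hN : AreInverse (e N') (e' N')) :
    pre (e N) N' = (inverseMap F G e e' N N' ≫ F.map (G N) (G N')) ≫
      post (F.obj (G N)) (e N') := by
  rw [inverseMap_comp, Category.assoc, hN.symm.post_comp_post, Category.comp_id]

lemma areInverse_comp_inv_map {X Y : A} {f : 𝟙_ V ⟶ (F.obj X ⟶[V] F.obj Y)}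
    {g : 𝟙_ V ⟶ (F.obj Y ⟶[V] F.obj X)} (hf : AreInverse f g) :
    AreInverse (f ≫ inv (F.map X Y)) (g ≫ inv (F.map Y X)) :=
  AreInverse.of_map F (by simpa using hf)

/-- A fully faithful and essentially surjective `V`-functor is an equivalence. -/
def equivalenceOfFullyFaithful : EnrichedEquivalence V A B where
  functor := F
  inverse := inverseOfFullyFaithful F G h
  unitIso := EnrichedNatIso.ofComponents (F := EnrichedFunctor.id V A)
    (G := F.comp V (inverseOfFullyFaithful F G h))
    (fun X => (e' (F.obj X) ≫ inv (F.map X (G (F.obj X))) : 𝟙_ V ⟶ (X ⟶[V] G (F.obj X))))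
    (fun X => (e (F.obj X) ≫ inv (F.map (G (F.obj X)) X) : 𝟙_ V ⟶ (G (F.obj X) ⟶[V] X)))
    (fun X => areInverse_comp_inv_map F (h (F.obj X)).symm)
    (fun X Y => (inverseMap_unit_naturality F G X Y (h _)).trans
      (Category.id_comp _).symm)
  counitIso := EnrichedNatIso.ofComponents e e' h (fun N N' =>
    (Category.id_comp _).trans (inverseMap_counit_naturality F G N N' (h _)))

end

namespace EnrichedEquivalence

variable (E : EnrichedEquivalence V A B)

lemma isIso_functor_map_comp_inverse_map (X Y : A) :
    IsIso (E.functor.map X Y ≫ E.inverse.map (E.functor.obj X) (E.functor.obj Y)) := by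
  have h1 := (E.unitIso.areInverse X).isIso_pre (E.inverse.obj (E.functor.obj Y))
  have h2 : IsIso ((E.functor.map X Y ≫ E.inverse.map (E.functor.obj X) (E.functor.obj Y)) ≫
      pre (E.unitIso.hom.app X) (E.inverse.obj (E.functor.obj Y))) := by
    have h := (E.unitIso.hom.map_pre X Y).trans (Category.id_comp _)
    have h3 := (E.unitIso.areInverse Y).isIso_post X
    exact h ▸ h3
  exact @IsIso.of_isIso_comp_right _ _ _ _ _ _ _ h1 h2

lemma isIso_inverse_map_comp_functor_map (X Y : B) :
    IsIso (E.inverse.map X Y ≫ E.functor.map (E.inverse.obj X) (E.inverse.obj Y)) := by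
  have h1 := (E.counitIso.areInverse Y).isIso_post (E.functor.obj (E.inverse.obj X))
  have h2 : IsIso ((E.inverse.map X Y ≫ E.functor.map (E.inverse.obj X) (E.inverse.obj Y)) ≫
      post (E.functor.obj (E.inverse.obj X)) (E.counitIso.hom.app Y)) := by
    have h := (Category.id_comp _).symm.trans (E.counitIso.hom.map_pre X Y)
    have h3 := (E.counitIso.areInverse X).isIso_pre Y
    exact h ▸ h3
  exact @IsIso.of_isIso_comp_right _ _ _ _ _ _ _ h1 h2

/-- The functor of an equivalence is fully faithful: the `2`-out-of-`6` property applies to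
`A(X, Y) ⟶ B(F X, F Y) ⟶ A(G F X, G F Y) ⟶ B(F G F X, F G F Y)`. -/
lemma isIso_functor_map (X Y : A) : IsIso (E.functor.map X Y) := by
  have h1 := E.isIso_functor_map_comp_inverse_map X Y
  have h2 := E.isIso_inverse_map_comp_functor_map (E.functor.obj X) (E.functor.obj Y)
  have h3 : IsIso (E.inverse.map (E.functor.obj X) (E.functor.obj Y)) := by
    have : IsSplitEpi (E.inverse.map (E.functor.obj X) (E.functor.obj Y)) :=
      IsSplitEpi.mk' ⟨inv (E.functor.map X Y ≫ E.inverse.map _ _) ≫ E.functor.map X Y, by simp⟩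
    have : Mono (E.inverse.map (E.functor.obj X) (E.functor.obj Y)) :=
      mono_of_mono _ (E.functor.map (E.inverse.obj _) (E.inverse.obj _))
    exact isIso_of_mono_of_isSplitEpi _
  exact IsIso.of_isIso_comp_right _ (E.inverse.map (E.functor.obj X) (E.functor.obj Y))

lemma exists_comp_functor_map {X Y : A} (f : 𝟙_ V ⟶ (E.functor.obj X ⟶[V] E.functor.obj Y)) :
    ∃ g : 𝟙_ V ⟶ (X ⟶[V] Y), g ≫ E.functor.map X Y = f := by
  have := E.isIso_functor_map X Y
  exact ⟨f ≫ inv (E.functor.map X Y), by simp⟩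

/-- An equivalence of `V`-categories induces an equivalence of underlying categories. -/
lemma isEquivalence_forget : E.functor.forget.IsEquivalence where
  faithful := ⟨fun {X Y} f g h => by
    have := E.isIso_functor_map X Y
    have h' : ForgetEnrichment.homTo V f ≫ E.functor.map X Y =
      ForgetEnrichment.homTo V g ≫ E.functor.map X Y := h
    exact homTo_injective ((cancel_mono (E.functor.map X Y)).1 h')⟩
  full := ⟨fun {_ _} f => E.exists_comp_functor_map f⟩
  essSurj := ⟨fun N => ⟨E.inverse.obj N, ⟨by
    have := (E.counitIso.areInverse N).isIso
    exact @asIso _ _ _ _ (ForgetEnrichment.homOf V (E.counitIso.hom.app N)) this⟩⟩⟩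

end EnrichedEquivalence

end Equivalence

/-! ### Tensors and their strengths -/

section Adjunction

variable {V : Type u} [Category.{v} V] [MonoidalCategory V]
variable {A : Type w₁} [EnrichedCategory V A] {B : Type w₂} [EnrichedCategory V B]

lemma EnrichedAdjunction.unit_post_map_counit {F : EnrichedFunctor V A B}
    {G : EnrichedFunctor V B A} (adj : EnrichedAdjunction F G) (Y : B) :
    adj.unit.app (G.obj Y) ≫ post (G.obj Y) (adj.counit.app Y ≫ G.map (F.obj (G.obj Y)) Y) =
      eId V (G.obj Y) := by
  have h := adj.right_triangle Y
  rw [← ForgetEnrichment.homOf_eId] at h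
  exact (homOf_post (adj.unit.app (G.obj Y)) (adj.counit.app Y ≫ G.map _ Y)).trans h

lemma EnrichedAdjunction.unit_map_post_counit {F : EnrichedFunctor V A B}
    {G : EnrichedFunctor V B A} (adj : EnrichedAdjunction F G) (X : A) :
    (adj.unit.app X ≫ F.map X (G.obj (F.obj X))) ≫ post (F.obj X) (adj.counit.app (F.obj X)) =
      eId V (F.obj X) := by
  have h := adj.left_triangle X
  rw [← ForgetEnrichment.homOf_eId] at h
  exact (homOf_post (adj.unit.app X ≫ F.map X _) (adj.counit.app (F.obj X))).trans h

/-- Transposition along an adjunction is bijective. The unit and counit are families of elements,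
with their naturality and the triangle identities stated by `post`; composites of functors are
unfolded in these hypotheses. -/
lemma bijective_transpose_of_triangles {F : EnrichedFunctor V A B} {G : EnrichedFunctor V B A}
    (η : ∀ X, 𝟙_ V ⟶ (X ⟶[V] G.obj (F.obj X))) (ε : ∀ Y, 𝟙_ V ⟶ (F.obj (G.obj Y) ⟶[V] Y))
    (hη : ∀ {X X' : A} (g : 𝟙_ V ⟶ (X ⟶[V] X')), g ≫ post X (η X') =
      η X ≫ post X (g ≫ F.map X X' ≫ G.map (F.obj X) (F.obj X')))
    (hε : ∀ {Y Y' : B} (f : 𝟙_ V ⟶ (Y ⟶[V] Y')),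
      (f ≫ G.map Y Y' ≫ F.map (G.obj Y) (G.obj Y')) ≫ post (F.obj (G.obj Y)) (ε Y') =
        ε Y ≫ post (F.obj (G.obj Y)) f)
    (left : ∀ X, (η X ≫ F.map X (G.obj (F.obj X))) ≫ post (F.obj X) (ε (F.obj X)) =
      eId V (F.obj X))
    (right : ∀ Y, η (G.obj Y) ≫ post (G.obj Y) (ε Y ≫ G.map (F.obj (G.obj Y)) Y) =
      eId V (G.obj Y)) (X : A) (Y : B) :
    Function.Bijective (fun f : 𝟙_ V ⟶ (F.obj X ⟶[V] Y) =>
      η X ≫ post X (f ≫ G.map (F.obj X) Y)) := by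
  refine Function.bijective_iff_has_inverse.2
    ⟨fun g => (g ≫ F.map X (G.obj Y)) ≫ post (F.obj X) (ε Y), fun f => ?_, fun g => ?_⟩
  · change ((η X ≫ post X (f ≫ G.map (F.obj X) Y)) ≫ F.map X (G.obj Y)) ≫
      post (F.obj X) (ε Y) = f
    rw [Category.assoc (η X), map_post, ← Category.assoc (η X), Category.assoc, ← post_comp,
      Category.assoc f, hε, post_comp, ← Category.assoc, left, eId_post]
  · change η X ≫ post X (((g ≫ F.map X (G.obj Y)) ≫ post (F.obj X) (ε Y)) ≫
      G.map (F.obj X) Y) = g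
    rw [Category.assoc, Category.assoc g, map_post, ← Category.assoc (F.map _ _),
      ← Category.assoc g, post_comp, ← Category.assoc, ← hη, Category.assoc, ← post_comp, right,
      post_eId, Category.comp_id]

/-- The transposition of elements along an enriched adjunction is bijective. -/
lemma EnrichedAdjunction.bijective_transpose {F : EnrichedFunctor V A B}
    {G : EnrichedFunctor V B A} (adj : EnrichedAdjunction F G) (X : A) (Y : B) :
    Function.Bijective (fun f : 𝟙_ V ⟶ (F.obj X ⟶[V] Y) =>
      (adj.unit.app X ≫ post X (f ≫ G.map (F.obj X) Y) : 𝟙_ V ⟶ (X ⟶[V] G.obj Y))) :=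
  bijective_transpose_of_triangles adj.unit.app adj.counit.app
    (fun g => (congrArg (· ≫ _) (Category.comp_id g).symm).trans (adj.unit.element_naturality g))
    (fun f => (adj.counit.element_naturality f).trans
      (congrArg (fun k => _ ≫ post _ k) (Category.comp_id f)))
    adj.unit_map_post_counit adj.unit_post_map_counit X Y

end Adjunction

section Tensor

variable {C : Type u} [Category.{v} C] [MonoidalCategory C]
variable {D : Type w₁} [EnrichedCategory C D]

/-- A morphism `z ⟶ D(Y, T)` exhibits `T` as a tensor of `z` and `Y` if it is universal, that is,
if morphisms `T ⟶ W` correspond to morphisms `z ⟶ D(Y, W)` of `C`. -/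
def IsTensor {z : C} {Y T : D} (η : z ⟶ (Y ⟶[C] T)) : Prop :=
  ∀ W : D, Function.Bijective (fun f : 𝟙_ C ⟶ (T ⟶[C] W) => η ≫ post Y f)

section Closed

variable [MonoidalClosed C]

/-- The underlying functor of `D(X, -)` acts by postcomposition. -/
lemma comp_curry_eComp (X : D) {Y Z : D} (f : 𝟙_ C ⟶ (Y ⟶[C] Z)) :
    f ≫ MonoidalClosed.curry (eComp C X Y Z) = MonoidalClosed.curry' (post X f) := by
  rw [← MonoidalClosed.curry_natural_left, MonoidalClosed.curry', post, Iso.hom_inv_id_assoc]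

lemma post_curry' (x : C) {y z : C} (f : y ⟶ z) :
    post (V := C) x (MonoidalClosed.curry' f) = (ihom x).map f :=
  MonoidalClosed.enrichedOrdinaryCategorySelf_eHomWhiskerLeft C x f

/-- The underlying functor of `D(X, -)`, with values in `C` itself instead of the underlying
category of its self-enrichment. -/
def homObjFunctor (X : D) : ForgetEnrichment C D ⥤ C where
  obj Y := EnrichedCategory.Hom (V := C) (C := D) X Y
  map {Y Z} f := post (A := D) X (Y := Y) (Z := Z) (ForgetEnrichment.homTo C f)
  map_id Y := by
    rw [ForgetEnrichment.homTo_id]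
    exact post_eId X Y
  map_comp f g := by
    rw [homTo_comp_eq_post]
    exact post_comp (A := D) X _ _

lemma isIso_toUnderlying_iff {x y : C} (f : x ⟶ y) : IsIso (toUnderlying f) ↔ IsIso f := by
  have : (ForgetEnrichment.equivInverse C C).IsEquivalence :=
    (ForgetEnrichment.equiv C (D := C)).isEquivalence_inverse
  exact isIso_iff_of_reflects_iso f (ForgetEnrichment.equivInverse C C)

/-- The underlying functor of `D(X, -)`, expressed by `homObjFunctor`. -/
def homFunctorForgetIso (X : D) :
    (homFunctor C X).forget ≅ homObjFunctor X ⋙ ForgetEnrichment.equivInverse C C :=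
  NatIso.ofComponents (fun _ => Iso.refl _) (fun {Y Z} f => by
    refine (Category.comp_id _).trans (Eq.trans ?_ (Category.id_comp _).symm)
    exact comp_curry_eComp (D := D) X (Y := Y) (Z := Z) (ForgetEnrichment.homTo C f))

lemma preservesCoequalizers_homFunctor_iff (X : D) :
    PreservesCoequalizers (homFunctor C X) ↔
      PreservesColimitsOfShape WalkingParallelPair (homObjFunctor (C := C) X) := by
  have : (ForgetEnrichment.equivInverse C C).IsEquivalence :=
    (ForgetEnrichment.equiv C (D := C)).isEquivalence_inverse
  constructor
  · intro h
    have : PreservesColimitsOfShape WalkingParallelPair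
        (homObjFunctor X ⋙ ForgetEnrichment.equivInverse C C) :=
      @preservesColimitsOfShape_of_natIso _ _ _ _ _ _ _ _ (homFunctorForgetIso X) h
    exact preservesColimitsOfShape_of_reflects_of_preserves _ (ForgetEnrichment.equivInverse C C)
  · intro h
    exact preservesColimitsOfShape_of_natIso (homFunctorForgetIso X).symm

lemma isConservative_homFunctor_iff (X : D) :
    IsConservative (homFunctor C X) ↔ (homObjFunctor (C := C) X).ReflectsIsomorphisms := by
  have : (ForgetEnrichment.equivInverse C C).IsEquivalence :=
    (ForgetEnrichment.equiv C (D := C)).isEquivalence_inverse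
  constructor
  · intro h
    have : (homObjFunctor X ⋙ ForgetEnrichment.equivInverse C C).ReflectsIsomorphisms :=
      @reflectsIsomorphisms_of_iso _ _ _ _ _ _ (homFunctorForgetIso X) h
    exact reflectsIsomorphisms_of_comp _ (ForgetEnrichment.equivInverse C C)
  · intro h
    exact reflectsIsomorphisms_of_iso (homFunctorForgetIso X).symm

/-- The unit `z ⟶ D(Y, z ⊛ Y)` of a tensored category. -/
def tensorUnit [Tensored C D] (z : C) (Y : D) : z ⟶ (Y ⟶[C] (Tensored.tensor (C := C) Y).obj z) :=
  MonoidalClosed.uncurry' ((Tensored.adj (C := C) Y).unit.app z)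

lemma curry'_tensorUnit [Tensored C D] (z : C) (Y : D) :
    MonoidalClosed.curry' (tensorUnit (C := C) z Y) = (Tensored.adj (C := C) Y).unit.app z :=
  MonoidalClosed.curry'_uncurry' _

/-- The universal property of `z ⊛ Y` is the bijection given by the adjunction
`- ⊛ Y ⊣ D(Y, -)`. -/
lemma isTensor_tensorUnit [Tensored C D] (z : C) (Y : D) :
    IsTensor (tensorUnit (C := C) z Y) := by
  intro W
  have h := (Tensored.adj (C := C) Y).bijective_transpose z W
  have h2 : (fun f : 𝟙_ C ⟶ ((Tensored.tensor (C := C) Y).obj z ⟶[C] W) =>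
      MonoidalClosed.curry' (tensorUnit z Y ≫ post Y f)) = fun f =>
        (Tensored.adj (C := C) Y).unit.app z ≫ post z (f ≫ (homFunctor C Y).map _ W) := by
    funext f
    rw [← MonoidalClosed.curry'_ihom_map, ← post_curry',
      curry'_tensorUnit, ← comp_curry_eComp]
    rfl
  exact (MonoidalClosed.curryHomEquiv'.bijective.of_comp_iff' _).1
    ((congrArg Function.Bijective h2).mpr h)

end Closed

/-- A fully faithful and essentially surjective functor preserves tensors. -/
lemma IsTensor.map {D' : Type w₂} [EnrichedCategory C D'] (F : EnrichedFunctor C D D')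
    [∀ X Y, IsIso (F.map X Y)] (hF : ∀ N : D', ∃ (X : D) (f : 𝟙_ C ⟶ (F.obj X ⟶[C] N))
      (g : 𝟙_ C ⟶ (N ⟶[C] F.obj X)), AreInverse f g)
    {z : C} {Y T : D} {η : z ⟶ (Y ⟶[C] T)} (h : IsTensor η) : IsTensor (η ≫ F.map Y T) := by
  intro N
  obtain ⟨W, f, g, hfg⟩ := hF N
  -- Morphisms `F T ⟶ N` are compared with morphisms `T ⟶ W`.
  let e₁ : (𝟙_ C ⟶ (T ⟶[C] W)) ≃ (𝟙_ C ⟶ (F.obj T ⟶[C] N)) :=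
    (asIso (F.map T W) ≪≫ hfg.postIso (F.obj T)).homToEquiv
  let e₂ : (z ⟶ (Y ⟶[C] W)) ≃ (z ⟶ (F.obj Y ⟶[C] N)) :=
    (asIso (F.map Y W) ≪≫ hfg.postIso (F.obj Y)).homToEquiv
  rw [← e₁.bijective.of_comp_iff]
  convert e₂.bijective.comp (h W) using 1
  funext k
  simp only [e₁, e₂, Iso.homToEquiv, Equiv.coe_fn_mk, Function.comp_apply, Iso.trans_hom,
    asIso_hom, AreInverse.postIso_hom, Category.assoc, reassoc_of% @map_post, ← post_comp]

variable [SymmetricCategory C]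

/-- The strength `z ⊗ D(X, Y) ⟶ D(X, T)` associated with a morphism `z ⟶ D(Y, T)`. -/
def homStrength (X : D) {z : C} {Y T : D} (η : z ⟶ (Y ⟶[C] T)) : z ⊗ (X ⟶[C] Y) ⟶ (X ⟶[C] T) :=
  (β_ _ _).hom ≫ _ ◁ η ≫ eComp C X Y T

lemma homStrength_post (X : D) {z : C} {Y T W : D} (η : z ⟶ (Y ⟶[C] T))
    (f : 𝟙_ C ⟶ (T ⟶[C] W)) :
    homStrength X η ≫ post X f = homStrength X (η ≫ post Y f) := by
  simp only [homStrength, Category.assoc, eComp_post, MonoidalCategory.whiskerLeft_comp]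

lemma whiskerRight_homStrength (X : D) {y z : C} {Y T : D} (g : y ⟶ z) (η : z ⟶ (Y ⟶[C] T)) :
    g ▷ _ ≫ homStrength X η = homStrength X (g ≫ η) := by
  rw [homStrength, BraidedCategory.braiding_naturality_left_assoc, homStrength,
    MonoidalCategory.whiskerLeft_comp_assoc]

lemma whiskerLeft_pre_homStrength {X X' : D} (f : 𝟙_ C ⟶ (X ⟶[C] X')) {z : C} {Y T : D}
    (η : z ⟶ (Y ⟶[C] T)) :
    z ◁ pre f Y ≫ homStrength X η = homStrength X' η ≫ pre f T := by
  simp only [homStrength, Category.assoc, eComp_pre]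
  rw [BraidedCategory.braiding_naturality_right_assoc, whisker_exchange_assoc]

lemma whiskerLeft_map_homStrength {D' : Type w₂} [EnrichedCategory C D']
    (F : EnrichedFunctor C D D') (X : D) {z : C} {Y T : D} (η : z ⟶ (Y ⟶[C] T)) :
    z ◁ F.map X Y ≫ homStrength (F.obj X) (η ≫ F.map Y T) = homStrength X η ≫ F.map X T := by
  simp only [homStrength, Category.assoc, F.map_comp]
  rw [BraidedCategory.braiding_naturality_right_assoc, MonoidalCategory.tensorHom_def',
    MonoidalCategory.whiskerLeft_comp]
  simp only [Category.assoc, whisker_exchange_assoc]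

section Closed

variable [MonoidalClosed C]

/-- The tensorial strength of `D(X, -)` is the composite of the unit of the tensor with the
composition of `D`. -/
lemma strength_homFunctor [Tensored C D] (X : D) (z : C) (Y : D) :
    strength (homFunctor C X) z Y = toUnderlying (homStrength X (tensorUnit z Y)) := by
  have h1 : (Tensored.adj (C := C) Y).unit.appHom z = toUnderlying (tensorUnit (C := C) z Y) := by
    rw [toUnderlying, curry'_tensorUnit]; rfl
  rw [strength, h1]
  refine (congrArg₂ (· ≫ ·) (tensorRightFunctor_forget_map _ _)
    (congrArg (· ≫ _) (tensorRightFunctor_forget_map _ _))).trans ?_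
  refine (congrArg (_ ≫ ·) (toUnderlying_comp _ (evalRight _ _))).trans ?_
  refine (toUnderlying_comp _ _).trans (congrArg toUnderlying ?_)
  rw [← comp_whiskerRight_assoc, whiskerRight_evalRight, homStrength,
    MonoidalClosed.uncurry_natural_left]
  exact congrArg (fun k => _ ≫ _ ≫ k) (MonoidalClosed.uncurry_curry _)

lemma preservesTensors_homFunctor_iff [Tensored C D] (X : D) :
    PreservesTensors (homFunctor C X) ↔
      ∀ (z : C) (Y : D), IsIso (homStrength X (tensorUnit (C := C) z Y)) := by
  refine forall_congr' fun z => forall_congr' fun Y => ?_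
  rw [strength_homFunctor]
  exact isIso_toUnderlying_iff _

end Closed

end Tensor

/-! ### Right modules -/

namespace RightMod

variable {C : Type u} [Category.{v} C] [MonoidalCategory C] [SymmetricCategory C]
  [MonoidalClosed C] {b : Mon C}

lemma epi_whiskerRight {x y : C} (f : x ⟶ y) [Epi f] (z : C) : Epi (f ▷ z) :=
  inferInstanceAs (Epi ((tensorRight z).map f))

/-- The quotient module structure along an epimorphism `π`. The module axioms hold because `π ⊗ z`
is again an epimorphism for every `z`. -/
def quotient {N : RightMod b} {Q : C} (π : N.obj ⟶ Q) [Epi π] (a : Q ⊗ b.X ⟶ Q)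
    (ha : π ▷ b.X ≫ a = N.act ≫ π) : RightMod b where
  obj := Q
  act := a
  act_one := by
    have := epi_whiskerRight π (𝟙_ C)
    rw [← cancel_epi (π ▷ 𝟙_ C), ← whisker_exchange_assoc, ha, reassoc_of% N.act_one,
      rightUnitor_naturality]
  act_mul := by
    have := epi_whiskerRight π (b.X ⊗ b.X)
    rw [← cancel_epi (π ▷ (b.X ⊗ b.X)), ← whisker_exchange_assoc, ha, reassoc_of% N.act_mul,
      associator_inv_naturality_left_assoc, ← comp_whiskerRight_assoc, ha, comp_whiskerRight_assoc,
      ha]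

/-- Coequalizers in `C` of linear morphisms carry a module structure, because `- ⊗ b` preserves
coequalizers. -/
lemma exists_coequalizer_act {M N : RightMod b} {f g : M.obj ⟶ N.obj} {Q : C} {π : N.obj ⟶ Q}
    {w : f ≫ π = g ≫ π} (hQ : IsColimit (Cofork.ofπ π w))
    (hf : M.act ≫ f = f ▷ b.X ≫ N.act) (hg : M.act ≫ g = g ▷ b.X ≫ N.act) :
    ∃ a : Q ⊗ b.X ⟶ Q, π ▷ b.X ≫ a = N.act ≫ π :=
  let h := isColimitCoforkMapOfIsColimit (tensorRight b.X) w hQ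
  ⟨_, (Cofork.IsColimit.desc' h (N.act ≫ π) (by
    dsimp
    rw [← reassoc_of% hf, ← reassoc_of% hg, w])).2⟩

variable [HasFiniteLimits C]

lemma hom_ext {M N : RightMod b} {P : C} {g g' : P ⟶ (M ⟶[C] N)}
    (h : g ≫ homι M N = g' ≫ homι M N) : g = g' :=
  (cancel_mono (homι M N)).1 h

/-- The transpose `M ⊗ P ⟶ N` of a morphism from `P` into the Hom object of modules. -/
def homTranspose {M N : RightMod b} {P : C} (g : P ⟶ (M ⟶[C] N)) : M.obj ⊗ P ⟶ N.obj :=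
  MonoidalClosed.uncurry (g ≫ homι M N)

lemma homTranspose_injective {M N : RightMod b} {P : C} {g g' : P ⟶ (M ⟶[C] N)}
    (h : homTranspose g = homTranspose g') : g = g' :=
  hom_ext (MonoidalClosed.uncurry_injective h)

/-- Morphisms into the Hom object of modules satisfy linearity after transposition. -/
lemma homTranspose_linear {M N : RightMod b} {P : C} (g : P ⟶ (M ⟶[C] N)) :
    M.act ▷ P ≫ homTranspose g = swapRight M.obj b.X P ≫ homTranspose g ▷ b.X ≫ N.act := by
  rw [homTranspose, ← equalizes_iff, Category.assoc, Category.assoc]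
  exact congrArg (g ≫ ·) (equalizer.condition _ _)

/-- A morphism into the Hom object of modules, from its transpose. -/
def homMk {M N : RightMod b} {P : C} (k : M.obj ⊗ P ⟶ N.obj)
    (h : M.act ▷ P ≫ k = swapRight M.obj b.X P ≫ k ▷ b.X ≫ N.act) : P ⟶ (M ⟶[C] N) :=
  equalizer.lift (MonoidalClosed.curry k)
    ((equalizes_iff _).2 (by rwa [MonoidalClosed.uncurry_curry]))

@[simp]
lemma homTranspose_homMk {M N : RightMod b} {P : C} (k : M.obj ⊗ P ⟶ N.obj)
    (h : M.act ▷ P ≫ k = swapRight M.obj b.X P ≫ k ▷ b.X ≫ N.act) :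
    homTranspose (homMk k h) = k := by
  have : homMk k h ≫ homι M N = MonoidalClosed.curry k := equalizer.lift_ι _ _
  rw [homTranspose, this, MonoidalClosed.uncurry_curry]

lemma homTranspose_comp {M N : RightMod b} {P P' : C} (p : P' ⟶ P) (g : P ⟶ (M ⟶[C] N)) :
    homTranspose (p ≫ g) = M.obj ◁ p ≫ homTranspose g := by
  rw [homTranspose, Category.assoc, MonoidalClosed.uncurry_natural_left, homTranspose]

lemma homTranspose_tensor_eComp {L M N : RightMod b} {P Q : C} (p : P ⟶ (L ⟶[C] M))
    (q : Q ⟶ (M ⟶[C] N)) : homTranspose ((p ⊗ₘ q) ≫ eComp C L M N) =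
      (α_ L.obj P Q).inv ≫ homTranspose p ▷ Q ≫ homTranspose q := by
  have h : eComp C L M N ≫ homι L N =
      (homι L M ⊗ₘ homι M N) ≫ MonoidalClosed.comp L.obj M.obj N.obj := homComp_ι L M N
  rw [homTranspose, Category.assoc, h, tensorHom_comp_tensorHom_assoc]
  exact uncurry_tensor_comp _ _

/-- The morphism of `C` underlying a morphism of modules. -/
def mapOf {M N : RightMod b} (f : 𝟙_ C ⟶ (M ⟶[C] N)) : M.obj ⟶ N.obj :=
  (ρ_ M.obj).inv ≫ homTranspose f

lemma mapOf_injective {M N : RightMod b} {f g : 𝟙_ C ⟶ (M ⟶[C] N)} (h : mapOf f = mapOf g) :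
    f = g :=
  homTranspose_injective ((cancel_epi _).1 h)

lemma act_mapOf {M N : RightMod b} (f : 𝟙_ C ⟶ (M ⟶[C] N)) :
    M.act ≫ mapOf f = mapOf f ▷ b.X ≫ N.act := by
  rw [mapOf, rightUnitor_inv_naturality_assoc, homTranspose_linear, comp_whiskerRight,
    Category.assoc, Iso.inv_comp_eq, ← swapRight_unit]
  simp

/-- The morphism of modules given by a linear morphism of `C`. -/
def ofMap {M N : RightMod b} (g : M.obj ⟶ N.obj) (h : M.act ≫ g = g ▷ b.X ≫ N.act) :
    𝟙_ C ⟶ (M ⟶[C] N) :=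
  homMk ((ρ_ M.obj).hom ≫ g) (by
    rw [rightUnitor_naturality_assoc, h, ← swapRight_unit]
    simp)

@[simp]
lemma mapOf_ofMap {M N : RightMod b} (g : M.obj ⟶ N.obj) (h : M.act ≫ g = g ▷ b.X ≫ N.act) :
    mapOf (ofMap g h) = g := by
  simp [mapOf, ofMap]

@[simp]
lemma mapOf_eId (M : RightMod b) : mapOf (eId C M) = 𝟙 M.obj := by
  have h : eId C M ≫ homι M M = MonoidalClosed.id M.obj := homId_ι M
  rw [mapOf, homTranspose, h, MonoidalClosed.id_eq, MonoidalClosed.uncurry_curry, Iso.inv_hom_id]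

lemma homTranspose_post {L M N : RightMod b} {P : C} (p : P ⟶ (L ⟶[C] M))
    (f : 𝟙_ C ⟶ (M ⟶[C] N)) :
    homTranspose (p ≫ post L f) = homTranspose p ≫ mapOf f := by
  have h : p ≫ post L f = (ρ_ P).inv ≫ (p ⊗ₘ f) ≫ eComp C L M N := by
    rw [post, rightUnitor_inv_naturality_assoc, MonoidalCategory.tensorHom_def, Category.assoc]
  rw [h, homTranspose_comp, homTranspose_tensor_eComp, mapOf, rightUnitor_inv_naturality_assoc]
  simp

lemma mapOf_post {L M N : RightMod b} (f : 𝟙_ C ⟶ (L ⟶[C] M)) (g : 𝟙_ C ⟶ (M ⟶[C] N)) :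
    mapOf (f ≫ post L g) = mapOf f ≫ mapOf g := by
  rw [mapOf, homTranspose_post, ← Category.assoc, ← mapOf]

lemma areInverse_ofMap {M N : RightMod b} (e : M.obj ≅ N.obj)
    (h : M.act ≫ e.hom = e.hom ▷ b.X ≫ N.act) :
    AreInverse (ofMap e.hom h) (ofMap (M := N) (N := M) e.inv (by
      rw [← cancel_mono e.hom, Category.assoc, Category.assoc, e.inv_hom_id, h,
        inv_hom_whiskerRight_assoc, Category.comp_id])) where
  hom_inv := mapOf_injective (by simp [mapOf_post])
  inv_hom := mapOf_injective (by simp [mapOf_post])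

variable (b) in
/-- The underlying functor of the forgetful functor from modules to `C`. -/
def forgetToBase : ForgetEnrichment C (RightMod b) ⥤ C where
  obj M := RightMod.obj (b := b) M
  map {M N} f := mapOf (M := M) (N := N) (ForgetEnrichment.homTo C f)
  map_id M := by
    rw [ForgetEnrichment.homTo_id]
    exact mapOf_eId (b := b) M
  map_comp f g := by
    rw [homTo_comp_eq_post]
    exact mapOf_post _ _

instance : (forgetToBase b).Faithful where
  map_injective h := mapOf_injective h

instance : (forgetToBase b).ReflectsIsomorphisms where
  reflects {M N} f hf := by
    have h := areInverse_ofMap (M := M) (N := N) (@asIso _ _ _ _ _ hf) (act_mapOf _)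
    have h2 : ofMap (M := M) (N := N) (@asIso _ _ _ _ _ hf).hom (act_mapOf _) =
        ForgetEnrichment.homTo C f := mapOf_injective (mapOf_ofMap _ _)
    exact (h2 ▸ h).isIso

/-! ### Coequalizers of right modules -/

/-- A cofork of modules whose underlying cofork is a coequalizer is a coequalizer. -/
lemma existsUnique_desc {M N Q : RightMod b} {f g : 𝟙_ C ⟶ (M ⟶[C] N)} {p : 𝟙_ C ⟶ (N ⟶[C] Q)}
    {w : mapOf f ≫ mapOf p = mapOf g ≫ mapOf p} (hQ : IsColimit (Cofork.ofπ (mapOf p) w))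
    {S : RightMod b} (k : 𝟙_ C ⟶ (N ⟶[C] S)) (hk : f ≫ post M k = g ≫ post M k) :
    ∃! l : 𝟙_ C ⟶ (Q ⟶[C] S), p ≫ post N l = k := by
  have hp : Epi (mapOf p) := epi_of_isColimit_cofork hQ
  obtain ⟨l, hl⟩ : ∃ l : Q.obj ⟶ S.obj, mapOf p ≫ l = mapOf k :=
    ⟨_, (Cofork.IsColimit.desc' hQ (mapOf k) (by rw [← mapOf_post, hk, mapOf_post])).2⟩
  have hlin : Q.act ≫ l = l ▷ b.X ≫ S.act := by
    have := epi_whiskerRight (mapOf p) b.X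
    rw [← cancel_epi (mapOf p ▷ b.X), ← reassoc_of% act_mapOf, hl, act_mapOf,
      ← comp_whiskerRight_assoc, hl]
  refine ⟨ofMap l hlin, mapOf_injective (by rw [mapOf_post, mapOf_ofMap, hl]), fun l' hl' => ?_⟩
  refine mapOf_injective ((cancel_epi (mapOf p)).1 ?_)
  rw [← mapOf_post, hl', mapOf_ofMap, hl]

lemma exists_isColimit_cofork [HasFiniteColimits C] {M N : RightMod b}
    (f g : 𝟙_ C ⟶ (M ⟶[C] N)) : ∃ (Q : RightMod b) (p : 𝟙_ C ⟶ (N ⟶[C] Q))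
      (w : mapOf f ≫ mapOf p = mapOf g ≫ mapOf p),
      Nonempty (IsColimit (Cofork.ofπ (mapOf p) w)) := by
  obtain ⟨a, ha⟩ := exists_coequalizer_act (coequalizerIsCoequalizer (mapOf f) (mapOf g))
    (act_mapOf f) (act_mapOf g)
  let p : 𝟙_ C ⟶ (N ⟶[C] quotient (coequalizer.π (mapOf f) (mapOf g)) a ha) :=
    ofMap (coequalizer.π (mapOf f) (mapOf g)) ha.symm
  have hp : mapOf p = coequalizer.π (mapOf f) (mapOf g) := mapOf_ofMap _ _
  exact ⟨_, p, (congrArg (_ ≫ ·) hp).trans ((coequalizer.condition _ _).trans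
      (congrArg (_ ≫ ·) hp).symm),
    ⟨IsColimit.ofIsoColimit (coequalizerIsCoequalizer (mapOf f) (mapOf g))
      (Cofork.ext (Iso.refl _) ((Category.comp_id _).trans hp.symm))⟩⟩

/-- Coequalizers of modules exist and are computed in `C`. -/
lemma preservesColimit_parallelPair [HasFiniteColimits C] {M N : RightMod b}
    (f g : 𝟙_ C ⟶ (M ⟶[C] N)) : PreservesColimit
      (parallelPair (ForgetEnrichment.homOf C f) (ForgetEnrichment.homOf C g))
      (forgetToBase b) := by
  obtain ⟨Q, p, w₀, ⟨hQ⟩⟩ := exists_isColimit_cofork f g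
  have w : ForgetEnrichment.homOf C f ≫ ForgetEnrichment.homOf C p =
      ForgetEnrichment.homOf C g ≫ ForgetEnrichment.homOf C p :=
    (forgetToBase b).map_injective (by
      rw [Functor.map_comp, Functor.map_comp]
      exact w₀)
  have hw : IsColimit (Cofork.ofπ (ForgetEnrichment.homOf C p) w) :=
    Cofork.IsColimit.mk' _ fun s => by
      have h := existsUnique_desc hQ (S := s.pt) (ForgetEnrichment.homTo C s.π)
        ((homTo_comp_eq_post (ForgetEnrichment.homOf C f) s.π).symm.trans
          ((congrArg (ForgetEnrichment.homTo C) s.condition).trans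
            (homTo_comp_eq_post (ForgetEnrichment.homOf C g) s.π)))
      refine ⟨ForgetEnrichment.homOf C h.choose, ?_, fun {m} hm => ?_⟩
      · exact (homOf_post _ _).symm.trans h.choose_spec.1
      · exact h.choose_spec.2 _ ((homTo_comp_eq_post _ _).symm.trans hm)
  exact preservesColimit_of_preserves_colimit_cocone hw
    ((isColimitMapCoconeCoforkEquiv _ w).symm hQ)

instance [HasFiniteColimits C] :
    PreservesColimitsOfShape WalkingParallelPair (forgetToBase b) where
  preservesColimit {K} :=
    have : PreservesColimit (parallelPair (K.map WalkingParallelPairHom.left)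
        (K.map WalkingParallelPairHom.right)) (forgetToBase b) := preservesColimit_parallelPair
      (ForgetEnrichment.homTo C (K.map WalkingParallelPairHom.left))
      (ForgetEnrichment.homTo C (K.map WalkingParallelPairHom.right))
    preservesColimit_of_iso_diagram (forgetToBase b) (diagramIsoParallelPair K).symm

end RightMod

/-! ### The regular module is a compact generator -/

section

variable {C : Type u} [Category.{v} C] [MonoidalCategory C] [SymmetricCategory C]

lemma braiding_swapRight (x y z : C) :
    (α_ x y z).inv ≫ (β_ x y).hom ▷ z ≫ swapRight y x z = (β_ x (y ⊗ z)).hom := by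
  rw [swapRight, BraidedCategory.braiding_tensor_right_hom]

lemma swapRight_braiding (x y z : C) :
    swapRight x y z ≫ (β_ x z).hom ▷ y = (β_ (x ⊗ y) z).hom ≫ (α_ z x y).inv := by
  rw [swapRight, BraidedCategory.braiding_tensor_left_hom]
  simp

lemma swapRight_swapRight (x y z : C) : swapRight x y z ≫ swapRight x z y = 𝟙 _ := by
  simp [swapRight, ← MonoidalCategory.whiskerLeft_comp_assoc]

end

namespace RightMod

variable {C : Type u} [Category.{v} C] [MonoidalCategory C] [SymmetricCategory C]
  [MonoidalClosed C] {b : Mon C}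

variable (b) in
/-- The monoid as a right module over itself. -/
abbrev regular : RightMod b where
  obj := b.X
  act := MonObj.mul
  act_one := MonObj.mul_one b.X
  act_mul := by rw [MonObj.mul_assoc, Iso.inv_hom_id_assoc]

/-- The module `z ⊗ M`. -/
abbrev tensorObj (z : C) (M : RightMod b) : RightMod b where
  obj := z ⊗ M.obj
  act := (α_ _ _ _).hom ≫ z ◁ M.act
  act_one := by
    rw [tensor_whiskerLeft]
    simp only [Category.assoc, Iso.inv_hom_id_assoc, ← MonoidalCategory.whiskerLeft_comp,
      M.act_one]
    simp
  act_mul := by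
    rw [tensor_whiskerLeft]
    simp only [Category.assoc, Iso.inv_hom_id_assoc, ← MonoidalCategory.whiskerLeft_comp,
      M.act_mul]
    simp

variable [HasFiniteLimits C]

/-- The morphism `N ⟶ Hom(b, N)` which sends an element `n` to `y ↦ n · y`. -/
def freeHom (N : RightMod b) : N.obj ⟶ (regular b ⟶[C] N) :=
  homMk ((β_ b.X N.obj).hom ≫ N.act) (by
    rw [BraidedCategory.braiding_naturality_left_assoc, N.act_mul, comp_whiskerRight_assoc,
      ← Category.assoc (swapRight _ _ _), swapRight_braiding, Category.assoc])

/-- Evaluation at the unit of `b`. -/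
def evalOne (N : RightMod b) : (regular b ⟶[C] N) ⟶ N.obj :=
  (λ_ _).inv ≫ MonObj.one ▷ _ ≫ homTranspose (M := regular b) (𝟙 (regular b ⟶[C] N))

lemma homTranspose_freeHom (N : RightMod b) {P : C} (p : P ⟶ N.obj) :
    homTranspose (p ≫ freeHom N) = b.X ◁ p ≫ (β_ b.X N.obj).hom ≫ N.act := by
  rw [homTranspose_comp, freeHom, homTranspose_homMk]

lemma freeHom_evalOne (N : RightMod b) : freeHom N ≫ evalOne N = 𝟙 N.obj := by
  have h : b.X ◁ freeHom N ≫ homTranspose (M := regular b) (𝟙 (regular b ⟶[C] N)) =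
      (β_ b.X N.obj).hom ≫ N.act := by
    have h1 := homTranspose_comp (M := regular b) (freeHom N) (𝟙 _)
    rw [Category.comp_id] at h1
    refine h1.symm.trans ?_
    have h2 := homTranspose_freeHom N (𝟙 _)
    rwa [Category.id_comp, MonoidalCategory.whiskerLeft_id, Category.id_comp] at h2
  rw [evalOne, leftUnitor_inv_naturality_assoc, whisker_exchange_assoc, h,
    BraidedCategory.braiding_naturality_left_assoc, N.act_one, braiding_rightUnitor,
    Iso.inv_hom_id]

/-- A linear morphism out of `b` is determined by its value at the unit. -/
lemma evalOne_freeHom (N : RightMod b) : evalOne N ≫ freeHom N = 𝟙 (regular b ⟶[C] N) := by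
  apply homTranspose_injective
  have h := homTranspose_linear (M := regular b) (𝟙 (regular b ⟶[C] N))
  rw [homTranspose_freeHom]
  have h2 := congrArg (fun k => ((λ_ b.X).inv ≫ MonObj.one ▷ b.X) ▷ (regular b ⟶[C] N) ≫ k) h
  rw [← comp_whiskerRight_assoc, Category.assoc, MonObj.one_mul, Iso.inv_hom_id,
    id_whiskerRight, Category.id_comp, comp_whiskerRight, Category.assoc,
    swapRight_natural_left_assoc] at h2
  refine Eq.trans ?_ h2.symm
  rw [BraidedCategory.braiding_naturality_right_assoc, evalOne]
  simp only [comp_whiskerRight, Category.assoc]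
  have h3 : (λ_ b.X).inv ▷ (regular b ⟶[C] N) ≫ swapRight (𝟙_ C) b.X (regular b ⟶[C] N) =
      (β_ b.X (regular b ⟶[C] N)).hom ≫ (λ_ _).inv ▷ b.X := by
    simp [swapRight]
  rw [reassoc_of% h3]

/-- The regular module represents the forgetful functor. -/
def freeIso (N : RightMod b) : N.obj ≅ (regular b ⟶[C] N) where
  hom := freeHom N
  inv := evalOne N
  hom_inv_id := freeHom_evalOne N
  inv_hom_id := evalOne_freeHom N

lemma freeHom_post {M N : RightMod b} (f : 𝟙_ C ⟶ (M ⟶[C] N)) :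
    freeHom M ≫ post (regular b) f = mapOf f ≫ freeHom N := by
  apply homTranspose_injective
  have h := homTranspose_freeHom M (𝟙 _)
  rw [Category.id_comp, MonoidalCategory.whiskerLeft_id, Category.id_comp] at h
  rw [homTranspose_post, homTranspose_freeHom, h, Category.assoc, act_mapOf,
    BraidedCategory.braiding_naturality_right_assoc]

/-- The functor represented by the regular module is the forgetful functor. -/
def forgetToBaseIso : forgetToBase b ≅ homObjFunctor (regular b) :=
  NatIso.ofComponents (fun N => freeIso (b := b) N) (fun _ => (freeHom_post _).symm)

/-- The action `z ⊗ M ⟶ N` of a morphism from `z` into the Hom object of modules. -/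
def actOf {z : C} {M N : RightMod b} (h : z ⟶ (M ⟶[C] N)) : z ⊗ M.obj ⟶ N.obj :=
  (β_ z M.obj).hom ≫ homTranspose h

/-- The strength of the regular module is identified by `freeIso` with the action `z ⊗ M ⟶ N`. -/
lemma whiskerLeft_freeHom_homStrength {z : C} {M N : RightMod b} (h : z ⟶ (M ⟶[C] N)) :
    z ◁ freeHom M ≫ homStrength (regular b) h = actOf h ≫ freeHom N := by
  apply homTranspose_injective
  have h1 := homTranspose_freeHom M (𝟙 _)
  rw [Category.id_comp, MonoidalCategory.whiskerLeft_id, Category.id_comp] at h1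
  rw [homStrength, BraidedCategory.braiding_naturality_right_assoc, ← tensorHom_def_assoc,
    homTranspose_comp, homTranspose_tensor_eComp, h1, homTranspose_freeHom, actOf,
    MonoidalCategory.whiskerLeft_comp, Category.assoc,
    BraidedCategory.braiding_naturality_right_assoc, comp_whiskerRight, Category.assoc,
    homTranspose_linear, ← braiding_swapRight]
  simp only [Category.assoc]

/-- The action of a morphism into the Hom object of modules is linear. -/
lemma act_actOf {z : C} {M N : RightMod b} (h : z ⟶ (M ⟶[C] N)) :
    (tensorObj z M).act ≫ actOf h = actOf h ▷ b.X ≫ N.act := by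
  rw [actOf, Category.assoc, BraidedCategory.braiding_naturality_right_assoc,
    homTranspose_linear, ← braiding_swapRight, comp_whiskerRight]
  simp only [Category.assoc, Iso.hom_inv_id_assoc, reassoc_of% swapRight_swapRight]

/-- Tensors of modules are computed in `C`: the module `z ⊗ M` has the universal property of a
tensor, so it is isomorphic to every other tensor of `z` and `M`. -/
lemma isIso_actOf {z : C} {M N : RightMod b} {h : z ⟶ (M ⟶[C] N)} (hh : IsTensor h) :
    IsIso (actOf h) := by
  let k : 𝟙_ C ⟶ (tensorObj z M ⟶[C] N) := ofMap (actOf h) (act_actOf h)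
  let h₀ : z ⟶ (M ⟶[C] tensorObj z M) := homMk (β_ M.obj z).hom (by
    rw [← Category.assoc (swapRight _ _ _), swapRight_braiding, Category.assoc,
      Iso.inv_hom_id_assoc, BraidedCategory.braiding_naturality_left])
  have hk : h₀ ≫ post M k = h := homTranspose_injective (by
    rw [homTranspose_post, homTranspose_homMk, mapOf_ofMap, actOf,
      SymmetricCategory.symmetry_assoc])
  obtain ⟨f, hf⟩ := (hh (tensorObj z M)).2 h₀
  have hf : h ≫ post M f = h₀ := hf
  have hfk : f ≫ post N k = eId C N := (hh N).1 (by
    simp only [post_comp, post_eId]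
    rw [reassoc_of% hf, hk, Category.comp_id])
  refine ⟨mapOf f, ?_, ?_⟩
  · rw [actOf, Category.assoc, ← homTranspose_post, hf, homTranspose_homMk,
      SymmetricCategory.symmetry]
  · have := congrArg mapOf hfk
    rwa [mapOf_post, mapOf_ofMap, mapOf_eId] at this

lemma isIso_homStrength_regular {z : C} {M N : RightMod b} {h : z ⟶ (M ⟶[C] N)}
    (hh : IsTensor h) : IsIso (homStrength (regular b) h) := by
  have := isIso_actOf hh
  have h1 := whiskerLeft_freeHom_homStrength h
  have h2 : IsIso (freeHom M) := (freeIso M).isIso_hom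
  have h3 : IsIso (freeHom N) := (freeIso N).isIso_hom
  rw [← IsIso.eq_inv_comp] at h1
  rw [h1]
  infer_instance

end RightMod

/-! ### Transport of compact generators along equivalences -/

section Transport

variable {C : Type u} [Category.{v} C] [MonoidalCategory C] [SymmetricCategory C]
variable {D : Type w₁} [EnrichedCategory C D] {D' : Type w₂} [EnrichedCategory C D']

/-- Isomorphic objects represent isomorphic functors. -/
def homObjFunctorCongr {X Y : D} {f : 𝟙_ C ⟶ (X ⟶[C] Y)} {g : 𝟙_ C ⟶ (Y ⟶[C] X)}
    (h : AreInverse f g) : homObjFunctor (C := C) Y ≅ homObjFunctor X :=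
  NatIso.ofComponents (fun Z => h.preIso (A := D) Z) (fun k => post_pre (A := D) f k)

/-- The action of a fully faithful functor on Hom objects. -/
def homIsoOfFullyFaithful (F : EnrichedFunctor C D D') [∀ X Y, IsIso (F.map X Y)] (X Y : D) :
    (X ⟶[C] Y) ≅ (F.obj X ⟶[C] F.obj Y) :=
  asIso (F.map X Y)

/-- A fully faithful functor is compatible with representable functors. -/
def homObjFunctorCompForget (F : EnrichedFunctor C D D') [∀ X Y, IsIso (F.map X Y)] (X : D) :
    homObjFunctor (C := C) X ≅ F.forget ⋙ homObjFunctor (F.obj X) :=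
  NatIso.ofComponents (fun Y => homIsoOfFullyFaithful F X Y) (fun k => map_post F X k)

/-- A fully faithful functor identifies endomorphism monoids. -/
def endMonoidMapIso (F : EnrichedFunctor C D D') [∀ X Y, IsIso (F.map X Y)] (X : D) :
    endMonoid C X ≅ endMonoid C (F.obj X) :=
  Mon.mkIso (homIsoOfFullyFaithful F X X) (F.map_id X) (by
    refine (Category.assoc _ _ _).trans ((congrArg (_ ≫ ·) (F.map_comp X X X)).trans ?_)
    exact (BraidedCategory.braiding_naturality_assoc _ _ _).symm)

/-- Isomorphic objects have isomorphic endomorphism monoids. -/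
def endMonoidCongr {X Y : D} {f : 𝟙_ C ⟶ (X ⟶[C] Y)} {g : 𝟙_ C ⟶ (Y ⟶[C] X)}
    (h : AreInverse f g) : endMonoid C Y ≅ endMonoid C X :=
  Mon.mkIso (h.preIso Y ≪≫ h.symm.postIso X)
    (by
      change eId C Y ≫ pre f Y ≫ post X g = eId C X
      rw [reassoc_of% eId_pre f, h.hom_inv])
    (by
      change ((β_ _ _).hom ≫ eComp C Y Y Y) ≫ pre f Y ≫ post X g =
        (pre f Y ≫ post X g ⊗ₘ pre f Y ≫ post X g) ≫ (β_ _ _).hom ≫ eComp C X X X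
      rw [BraidedCategory.braiding_naturality_assoc, h.eComp_conj, Category.assoc])

/-- Invertibility of strengths is invariant under isomorphism. -/
lemma AreInverse.isIso_homStrength {X Y : D} {f : 𝟙_ C ⟶ (X ⟶[C] Y)} {g : 𝟙_ C ⟶ (Y ⟶[C] X)}
    (h : AreInverse f g) {z : C} {Z T : D} (η : z ⟶ (Z ⟶[C] T))
    (hη : IsIso (homStrength X η)) :
    IsIso (homStrength Y η) := by
  have h1 := whiskerLeft_pre_homStrength f η
  have := h.isIso_pre T
  have := h.isIso_pre Z
  have : IsIso (homStrength Y η ≫ pre f T) := h1 ▸ inferInstance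
  exact IsIso.of_isIso_comp_right _ (pre f T)

lemma isIso_homStrength_of_map (F : EnrichedFunctor C D D') [∀ X Y, IsIso (F.map X Y)] (X : D)
    {z : C} {Y T : D} (η : z ⟶ (Y ⟶[C] T))
    (hη : IsIso (homStrength (F.obj X) (η ≫ F.map Y T))) :
    IsIso (homStrength X η) := by
  have h1 := whiskerLeft_map_homStrength F X η
  have : IsIso (homStrength X η ≫ F.map X T) := h1 ▸ inferInstance
  exact IsIso.of_isIso_comp_right _ (F.map X T)

variable [MonoidalClosed C] [HasFiniteLimits C] [HasFiniteColimits C] {b : Mon C}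

/-- The endomorphisms of the regular module are the left multiplications. -/
def endMonoidRegularIso : b ≅ endMonoid C (RightMod.regular b) :=
  Mon.mkIso (RightMod.freeIso (RightMod.regular b))
    (by
      change MonObj.one ≫ RightMod.freeHom (RightMod.regular b) = eId C (RightMod.regular b)
      apply RightMod.mapOf_injective
      rw [RightMod.mapOf, RightMod.homTranspose_freeHom, RightMod.mapOf_eId,
        BraidedCategory.braiding_naturality_right_assoc, MonObj.one_mul, braiding_leftUnitor,
        Iso.inv_hom_id])
    (by
      have h := RightMod.whiskerLeft_freeHom_homStrength (RightMod.freeHom (RightMod.regular b))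
      have h2 : RightMod.actOf (RightMod.freeHom (RightMod.regular b)) = MonObj.mul := by
        have h3 := RightMod.homTranspose_freeHom (RightMod.regular b) (𝟙 _)
        rw [Category.id_comp, MonoidalCategory.whiskerLeft_id, Category.id_comp] at h3
        rw [RightMod.actOf, h3, SymmetricCategory.symmetry_assoc]
      rw [h2, homStrength] at h
      refine h.symm.trans ?_
      change _ = (_ ⊗ₘ _) ≫ (β_ _ _).hom ≫ eComp C _ _ _
      rw [← BraidedCategory.braiding_naturality_left_assoc, MonoidalCategory.tensorHom_def',
        Category.assoc]
      rfl)

/-- An equivalence with a category of modules yields a compact generator, namely an object sent to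
the regular module. -/
lemma EnrichedEquivalence.exists_isCompactGenerator [Tensored C D]
    (E : EnrichedEquivalence C D (RightMod b)) :
    ∃ X : D, IsCompactGenerator C X ∧ Nonempty (b ≅ endMonoid C X) := by
  have hE := E.isIso_functor_map
  have := E.isEquivalence_forget
  have he := E.counitIso.areInverse (RightMod.regular b)
  let X : D := E.inverse.obj (RightMod.regular b)
  have he' : AreInverse (X := E.functor.obj X) (E.counitIso.hom.app (RightMod.regular b))
    (E.counitIso.inv.app (RightMod.regular b)) := he
  -- `D(X, -)` is the composite of the equivalence and the forgetful functor.
  let e : homObjFunctor (C := C) X ≅ E.functor.forget ⋙ RightMod.forgetToBase b :=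
    homObjFunctorCompForget E.functor X ≪≫ Functor.isoWhiskerLeft E.functor.forget
      ((homObjFunctorCongr he').symm ≪≫ RightMod.forgetToBaseIso.symm)
  refine ⟨X, ⟨⟨?_, ?_⟩, ?_⟩, ⟨endMonoidRegularIso ≪≫ endMonoidCongr he' ≪≫
    (endMonoidMapIso E.functor X).symm⟩⟩
  · rw [preservesTensors_homFunctor_iff]
    intro z Y
    -- The image of a tensor is a tensor of modules, so the strength of `b` at it is invertible.
    have hη := (isTensor_tensorUnit (C := C) z Y).map E.functor (fun N =>
      ⟨E.inverse.obj N, _, _, E.counitIso.areInverse N⟩)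
    exact isIso_homStrength_of_map E.functor X _
      (he'.symm.isIso_homStrength _ (RightMod.isIso_homStrength_regular hη))
  · rw [preservesCoequalizers_homFunctor_iff]
    exact preservesColimitsOfShape_of_natIso e.symm
  · refine (isConservative_homFunctor_iff X).2 ?_
    exact reflectsIsomorphisms_of_iso e.symm

end Transport

/-! ### The modules `D(X, Y)` over an endomorphism monoid -/

section RevComp

variable {C : Type u} [Category.{v} C] [MonoidalCategory C] [SymmetricCategory C]
variable {D : Type w₁} [EnrichedCategory C D]

/-- Composition `D(X, Y) ⊗ D(W, X) ⟶ D(W, Y)`, with the morphism applied last written first. -/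
def revComp (W X Y : D) : (X ⟶[C] Y) ⊗ (W ⟶[C] X) ⟶ (W ⟶[C] Y) :=
  (β_ _ _).hom ≫ eComp C W X Y

lemma homStrength_eq_revComp (X : D) {z : C} {Y T : D} (η : z ⟶ (Y ⟶[C] T)) :
    homStrength X η = η ▷ _ ≫ revComp X Y T := by
  rw [homStrength, revComp, BraidedCategory.braiding_naturality_left_assoc]

lemma revComp_assoc (V W X Y : D) :
    revComp (C := C) W X Y ▷ (V ⟶[C] W) ≫ revComp V W Y =
      (α_ _ _ _).hom ≫ (X ⟶[C] Y) ◁ revComp V W X ≫ revComp V X Y := by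
  simp only [revComp, comp_whiskerRight, MonoidalCategory.whiskerLeft_comp, Category.assoc]
  rw [BraidedCategory.braiding_naturality_left_assoc, ← e_assoc,
    BraidedCategory.braiding_naturality_right_assoc,
    BraidedCategory.braiding_tensor_left_hom, BraidedCategory.braiding_tensor_right_hom]
  simp only [Category.assoc, Iso.hom_inv_id_assoc]
  rw [← BraidedCategory.yang_baxter_assoc]
  simp [e_assoc']

lemma revComp_post (W X : D) {Y Z : D} (f : 𝟙_ C ⟶ (Y ⟶[C] Z)) :
    revComp W X Y ≫ post W f = post X f ▷ _ ≫ revComp W X Z := by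
  rw [revComp, Category.assoc, eComp_post, revComp,
    BraidedCategory.braiding_naturality_left_assoc]

lemma whiskerLeft_eId_revComp (X Y : D) :
    (X ⟶[C] Y) ◁ eId C X ≫ revComp X X Y = (ρ_ _).hom := by
  rw [revComp, BraidedCategory.braiding_naturality_right_assoc,
    (Iso.inv_comp_eq _).1 (e_id_comp C X Y), Category.comp_id, braiding_leftUnitor]

lemma whiskerLeft_eId_homStrength (X : D) {z : C} {T : D} (η : z ⟶ (X ⟶[C] T)) :
    z ◁ eId C X ≫ homStrength X η = (ρ_ z).hom ≫ η := by
  rw [homStrength_eq_revComp, whisker_exchange_assoc, whiskerLeft_eId_revComp,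
    rightUnitor_naturality]

variable {b : Mon C}

/-- The morphism `φ` from `b` to `D(X, X)` is a morphism of monoids into `endMonoid C X`. -/
structure IsEndHom (X : D) (φ : b.X ⟶ (X ⟶[C] X)) : Prop where
  one_comp : MonObj.one ≫ φ = eId C X
  mul_comp : MonObj.mul ≫ φ = (φ ⊗ₘ φ) ≫ revComp X X X

variable {X : D} {φ : b.X ⟶ (X ⟶[C] X)} (hφ : IsEndHom X φ)

/-- The right `b`-module `D(X, Y)`. -/
abbrev homModule (Y : D) : RightMod b where
  obj := X ⟶[C] Y
  act := (X ⟶[C] Y) ◁ φ ≫ revComp X X Y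
  act_one := by
    rw [← MonoidalCategory.whiskerLeft_comp_assoc, hφ.one_comp, whiskerLeft_eId_revComp]
  act_mul := by
    rw [← MonoidalCategory.whiskerLeft_comp_assoc, hφ.mul_comp, comp_whiskerRight, Category.assoc,
      ← whisker_exchange_assoc, revComp_assoc, MonoidalCategory.tensorHom_def]
    simp

lemma homModule_act_post {Y Z : D} (f : 𝟙_ C ⟶ (Y ⟶[C] Z)) :
    (homModule hφ Y).act ≫ post X f = post X f ▷ b.X ≫ (homModule hφ Z).act := by
  rw [Category.assoc, revComp_post, whisker_exchange_assoc]

/-- Strengths are linear. -/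
lemma tensorObj_act_homStrength {z : C} {Y T : D} (η : z ⟶ (Y ⟶[C] T)) :
    (RightMod.tensorObj z (homModule hφ Y)).act ≫ homStrength X η =
      homStrength X η ▷ b.X ≫ (homModule hφ T).act := by
  simp only [homStrength_eq_revComp, MonoidalCategory.whiskerLeft_comp, Category.assoc,
    comp_whiskerRight]
  rw [← whisker_exchange_assoc, revComp_assoc]
  simp only [tensor_whiskerLeft, Category.assoc, Iso.inv_hom_id_assoc]
  rw [associator_naturality_left_assoc, whisker_exchange_assoc, whisker_exchange_assoc]

/-- The morphism `z ⊗ b ⟶ D(X, T)` which sends `m ⊗ y` to `η(m) ∘ φ(y)`. -/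
def freeStrength (φ : b.X ⟶ (X ⟶[C] X)) {z : C} {T : D} (η : z ⟶ (X ⟶[C] T)) :
    z ⊗ b.X ⟶ (X ⟶[C] T) :=
  z ◁ φ ≫ homStrength X η

lemma freeStrength_eq_act {z : C} {T : D} (η : z ⟶ (X ⟶[C] T)) :
    freeStrength φ η = η ▷ b.X ≫ (homModule hφ T).act := by
  rw [freeStrength, homStrength_eq_revComp, whisker_exchange_assoc]

lemma freeStrength_post {z : C} {T W : D} (η : z ⟶ (X ⟶[C] T)) (f : 𝟙_ C ⟶ (T ⟶[C] W)) :
    freeStrength φ η ≫ post X f = freeStrength φ (η ≫ post X f) := by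
  rw [freeStrength, Category.assoc, homStrength_post, freeStrength]

lemma freeStrength_comp {y z : C} {T : D} (g : y ⟶ z) (η : z ⟶ (X ⟶[C] T)) :
    freeStrength φ (g ≫ η) = g ▷ b.X ≫ freeStrength φ η := by
  rw [freeStrength, ← whiskerRight_homStrength, whisker_exchange_assoc, freeStrength]

/-- Under the strengths, the morphism corresponding to the action of `b` on `D(X, T)` is
multiplication in `b`. -/
lemma freeStrength_freeStrength (hφ : IsEndHom X φ) {z : C} {T : D} (η : z ⟶ (X ⟶[C] T)) :
    freeStrength φ (freeStrength φ η) =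
      (α_ _ _ _).hom ≫ z ◁ MonObj.mul ≫ freeStrength φ η := by
  rw [freeStrength_eq_act hφ (freeStrength φ η), freeStrength_eq_act hφ η, comp_whiskerRight,
    Category.assoc, whisker_exchange_assoc]
  refine Eq.trans ?_ (congrArg (fun k => _ ≫ _ ≫ k) (homModule hφ T).act_mul).symm
  simp only [associator_inv_naturality_left_assoc, Iso.hom_inv_id_assoc]

lemma unit_freeStrength (hφ : IsEndHom X φ) {z : C} {T : D} (η : z ⟶ (X ⟶[C] T)) :
    (ρ_ z).inv ≫ z ◁ MonObj.one ≫ freeStrength φ η = η := by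
  rw [freeStrength, ← MonoidalCategory.whiskerLeft_comp_assoc, hφ.one_comp,
    whiskerLeft_eId_homStrength, Iso.inv_hom_id_assoc]

end RevComp

/-! ### The comparison functor `Y ↦ D(X, Y)` -/

namespace RightMod

variable {C : Type u} [Category.{v} C] [MonoidalCategory C] [SymmetricCategory C]
  [MonoidalClosed C] [HasFiniteLimits C] {b : Mon C}

/-- The morphism into the Hom object of modules which corresponds to a linear action. -/
def homOfAct {z : C} {M N : RightMod b} (k : z ⊗ M.obj ⟶ N.obj)
    (hk : (tensorObj z M).act ≫ k = k ▷ b.X ≫ N.act) : z ⟶ (M ⟶[C] N) :=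
  homMk ((β_ M.obj z).hom ≫ k) (by
    rw [BraidedCategory.braiding_naturality_left_assoc, comp_whiskerRight, Category.assoc, ← hk,
      ← Category.assoc (swapRight _ _ _), swapRight_braiding]
    simp only [Category.assoc, Iso.inv_hom_id_assoc])

@[simp]
lemma homTranspose_homOfAct {z : C} {M N : RightMod b} (k : z ⊗ M.obj ⟶ N.obj)
    (hk : (tensorObj z M).act ≫ k = k ▷ b.X ≫ N.act) :
    homTranspose (homOfAct k hk) = (β_ M.obj z).hom ≫ k :=
  homTranspose_homMk _ _

@[simp]
lemma actOf_homOfAct {z : C} {M N : RightMod b} (k : z ⊗ M.obj ⟶ N.obj)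
    (hk : (tensorObj z M).act ≫ k = k ▷ b.X ≫ N.act) : actOf (homOfAct k hk) = k := by
  rw [actOf, homTranspose_homOfAct, SymmetricCategory.symmetry_assoc]

lemma actOf_comp {y z : C} {M N : RightMod b} (p : y ⟶ z) (h : z ⟶ (M ⟶[C] N)) :
    actOf (p ≫ h) = p ▷ M.obj ≫ actOf h := by
  rw [actOf, homTranspose_comp, actOf, BraidedCategory.braiding_naturality_left_assoc]

lemma actOf_injective {z : C} {M N : RightMod b} {h h' : z ⟶ (M ⟶[C] N)}
    (e : actOf h = actOf h') : h = h' :=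
  homTranspose_injective ((cancel_epi _).1 e)

end RightMod

section Comparison

variable {C : Type u} [Category.{v} C] [MonoidalCategory C]
variable {D : Type w₁} [EnrichedCategory C D]

/-- Coequalizers in the underlying category, in terms of elements of Hom objects. -/
lemma exists_coequalizer [HasCoequalizers (ForgetEnrichment C D)] (X : D)
    [PreservesColimitsOfShape WalkingParallelPair (homObjFunctor (C := C) X)]
    {Y Z : D} (p q : 𝟙_ C ⟶ (Y ⟶[C] Z)) :
    ∃ (Q : D) (π : 𝟙_ C ⟶ (Z ⟶[C] Q)) (w : post X p ≫ post X π = post X q ≫ post X π),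
      p ≫ post Y π = q ≫ post Y π ∧
      (∀ (W : D) (f : 𝟙_ C ⟶ (Z ⟶[C] W)), p ≫ post Y f = q ≫ post Y f →
        ∃ h : 𝟙_ C ⟶ (Q ⟶[C] W), π ≫ post Z h = f) ∧
      (∀ (W : D) (h h' : 𝟙_ C ⟶ (Q ⟶[C] W)), π ≫ post Z h = π ≫ post Z h' → h = h') ∧
      Nonempty (IsColimit (Cofork.ofπ (post X π) w)) := by
  let P := ForgetEnrichment.homOf C p
  let R := ForgetEnrichment.homOf C q
  let Q : ForgetEnrichment C D := coequalizer P R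
  let π : ForgetEnrichment.of C Z ⟶ Q := coequalizer.π P R
  have w : P ≫ π = R ≫ π := coequalizer.condition P R
  have w₀ : p ≫ post Y (ForgetEnrichment.homTo C π) = q ≫ post Y (ForgetEnrichment.homTo C π) :=
    (homTo_comp_eq_post P π).symm.trans
      ((congrArg (ForgetEnrichment.homTo C) w).trans (homTo_comp_eq_post R π))
  have hπ := isColimitCoforkMapOfIsColimit (homObjFunctor X) w (coequalizerIsCoequalizer P R)
  have w₁ : post X p ≫ post X (Z := (Q : D)) (ForgetEnrichment.homTo C π) =
      post X q ≫ post X (Z := (Q : D)) (ForgetEnrichment.homTo C π) :=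
    (post_comp X p _).symm.trans ((congrArg (post X) w₀).trans (post_comp X q _))
  refine ⟨Q, ForgetEnrichment.homTo C π, w₁, w₀, fun W f hf => ?_, fun W h h' e => ?_, ⟨hπ⟩⟩
  · have hf' : P ≫ ForgetEnrichment.homOf C f = R ≫ ForgetEnrichment.homOf C f :=
      homTo_injective ((homTo_comp_eq_post P _).trans (hf.trans (homTo_comp_eq_post R _).symm))
    exact ⟨ForgetEnrichment.homTo C (coequalizer.desc _ hf'),
      (homTo_comp_eq_post π _).symm.trans
        (congrArg (ForgetEnrichment.homTo C) (coequalizer.π_desc _ hf'))⟩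
  · have e' : π ≫ ForgetEnrichment.homOf C h = π ≫ ForgetEnrichment.homOf C h' :=
      homTo_injective ((homTo_comp_eq_post π _).trans (e.trans (homTo_comp_eq_post π _).symm))
    exact congrArg (ForgetEnrichment.homTo C) (coequalizer.hom_ext (f := P) (g := R) e')

variable [SymmetricCategory C]

lemma homStrength_id (X Y T : D) : homStrength X (𝟙 (Y ⟶[C] T)) = revComp X Y T := by
  rw [homStrength_eq_revComp, id_whiskerRight, Category.id_comp]

variable {b : Mon C} {X : D} {φ : b.X ⟶ (X ⟶[C] X)}

/-- Every module is `D(X, Q)` for some `Q`, and `Q` represents linear morphisms out of the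
module. Since the strength identifies `D(X, z ⊛ X)` with `z ⊗ b`, the presentation of `M` as a
coequalizer of `(M ⊗ b) ⊗ b ⇉ M ⊗ b` lifts to `D`. -/
lemma exists_represents (hφ : IsEndHom X φ) [IsIso φ] [MonoidalClosed C] [Tensored C D]
    [HasCoequalizers (ForgetEnrichment C D)] (hX : IsCompactObject C X) (M : RightMod b) :
    ∃ (Q : D) (θ : M.obj ⟶ (X ⟶[C] Q)), IsIso θ ∧
      M.act ≫ θ = θ ▷ b.X ≫ (homModule hφ Q).act ∧
      ∀ (W : D) (g : M.obj ⟶ (X ⟶[C] W)), M.act ≫ g = g ▷ b.X ≫ (homModule hφ W).act →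
        ∃! h : 𝟙_ C ⟶ (Q ⟶[C] W), θ ≫ post X h = g := by
  have := (preservesCoequalizers_homFunctor_iff X).1 hX.preservesCoequalizers
  have hstr := (preservesTensors_homFunctor_iff X).1 hX.preservesTensors
  have hη := isTensor_tensorUnit (C := C) M.obj X
  have hη' := isTensor_tensorUnit (C := C) (M.obj ⊗ b.X) X
  have hs : IsIso (freeStrength φ (tensorUnit (C := C) M.obj X)) :=
    have := hstr M.obj X
    inferInstanceAs (IsIso (_ ≫ _))
  have hs' : IsIso (freeStrength φ (tensorUnit (C := C) (M.obj ⊗ b.X) X)) :=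
    have := hstr (M.obj ⊗ b.X) X
    inferInstanceAs (IsIso (_ ≫ _))
  -- From here on only the universal properties of the tensors `T` and `T'` matter.
  generalize tensorUnit (C := C) M.obj X = η at *
  generalize tensorUnit (C := C) (M.obj ⊗ b.X) X = η' at *
  generalize (Tensored.tensor (C := C) X).obj M.obj = T at *
  generalize (Tensored.tensor (C := C) X).obj (M.obj ⊗ b.X) = T' at *
  -- `p` and `q` lift the action of `b` on `M` and the multiplication of `b`.
  obtain ⟨p, hp⟩ := (hη' T).2 (M.act ≫ η)
  obtain ⟨q, hq⟩ := (hη' T).2 (freeStrength φ η)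
  dsimp only at hp hq
  obtain ⟨Q, π, w, hπ, hdesc, huniq, ⟨hQ⟩⟩ := exists_coequalizer X p q
  -- A morphism out of `T` coequalizes `p` and `q` if and only if its transpose is linear.
  have key {W : D} (f : 𝟙_ C ⟶ (T ⟶[C] W)) : p ≫ post T' f = q ≫ post T' f ↔
      M.act ≫ η ≫ post X f = (η ≫ post X f) ▷ b.X ≫ (homModule hφ W).act := by
    rw [← (hη' W).1.eq_iff]
    dsimp only
    rw [post_comp, post_comp, reassoc_of% hp, reassoc_of% hq, freeStrength_post,
      freeStrength_eq_act hφ]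
  have hlin := (key π).1 hπ
  refine ⟨Q, η ≫ post X π, ?_, hlin, fun W g hg => ?_⟩
  -- The action `M ⊗ b ⟶ M`, composed with the inverse of the strength, descends to `D(X, Q)`.
  · have hcond : post X p ≫ inv (freeStrength φ η) ≫ M.act =
        post X q ≫ inv (freeStrength φ η) ≫ M.act := by
      have e₁ : freeStrength φ η' ≫ post X p = M.act ▷ b.X ≫ freeStrength φ η := by
        rw [freeStrength_post, hp, freeStrength_comp]
      have e₂ : freeStrength φ η' ≫ post X q =
          (α_ _ _ _).hom ≫ M.obj ◁ MonObj.mul ≫ freeStrength φ η := by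
        rw [freeStrength_post, hq, freeStrength_freeStrength hφ]
      rw [← cancel_epi (freeStrength φ η'), reassoc_of% e₁, reassoc_of% e₂]
      simp only [IsIso.hom_inv_id_assoc]
      rw [M.act_mul, Iso.hom_inv_id_assoc]
    obtain ⟨r, hr⟩ := Cofork.IsColimit.desc' hQ _ hcond
    have hr : post X π ≫ r = inv (freeStrength φ η) ≫ M.act := hr
    refine ⟨r, ?_, ?_⟩
    · have e₃ : η ≫ inv (freeStrength φ η) = (ρ_ _).inv ≫ M.obj ◁ MonObj.one := by
        rw [IsIso.comp_inv_eq, Category.assoc, unit_freeStrength hφ]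
      rw [Category.assoc, hr, reassoc_of% e₃, M.act_one, Iso.inv_hom_id]
    · have : Epi (post X π) := epi_of_isColimit_cofork hQ
      rw [← cancel_epi (post X π), reassoc_of% hr, hlin, ← freeStrength_eq_act hφ,
        ← freeStrength_post, IsIso.inv_hom_id_assoc, Category.comp_id]
  · obtain ⟨f, hf⟩ := (hη W).2 g
    dsimp only at hf
    obtain ⟨h, hh⟩ := hdesc W f ((key f).2 (by rw [hf, hg]))
    refine ⟨h, ?_, fun h' hh' => huniq _ _ _ ((hη W).1 ?_)⟩
    · dsimp only
      rw [Category.assoc, ← post_comp, hh, hf]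
    · dsimp only at hh' ⊢
      rw [hh, hf, post_comp, ← Category.assoc, hh']

/-- The underlying functor of `Y ↦ D(X, Y)` is fully faithful, as a functor to modules. -/
lemma existsUnique_post_eq (hφ : IsEndHom X φ) [IsIso φ] [MonoidalClosed C] [Tensored C D]
    [HasCoequalizers (ForgetEnrichment C D)] (hX : IsCompactGenerator C X) {Y W : D}
    (g : (X ⟶[C] Y) ⟶ (X ⟶[C] W))
    (hg : (homModule hφ Y).act ≫ g = g ▷ b.X ≫ (homModule hφ W).act) :
    ∃! k : 𝟙_ C ⟶ (Y ⟶[C] W), post X k = g := by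
  have := (isConservative_homFunctor_iff X).1 hX.isGenerator
  -- The identity of `D(X, Y)` corresponds to `ε : Q ⟶ Y`, which `D(X, -)` makes invertible.
  obtain ⟨Q, θ, hθ, -, hQ⟩ := exists_represents hφ hX.isCompactObject (homModule hφ Y)
  obtain ⟨ε, hε, -⟩ := hQ Y (𝟙 _) (by simp)
  dsimp only at hε
  have h1 : IsIso (post X ε) := IsIso.of_isIso_fac_left hε
  have h2 : IsIso (ForgetEnrichment.homOf C ε) := by
    have : IsIso ((homObjFunctor X).map (ForgetEnrichment.homOf C ε)) := h1
    exact isIso_of_reflects_iso _ (homObjFunctor X)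
  obtain ⟨ε', h⟩ : ∃ ε' : 𝟙_ C ⟶ (Y ⟶[C] Q), AreInverse ε ε' :=
    ⟨_, areInverse_of_iso (asIso (ForgetEnrichment.homOf C ε))⟩
  obtain ⟨k, hk, hk'⟩ := hQ W g hg
  dsimp only at hk hk'
  have h3 : post X ε' = θ := by
    rw [← cancel_mono (post X ε), h.symm.post_comp_post, hε]
  refine ⟨ε' ≫ post Y k, by dsimp only; rw [post_comp, h3, hk], fun l hl => ?_⟩
  have h4 := hk' (ε ≫ post Q l) (by rw [post_comp, reassoc_of% hε, hl])
  rw [← h4, post_comp, ← Category.assoc, h.inv_hom, eId_post]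

variable [MonoidalClosed C] [HasFiniteLimits C] (hφ : IsEndHom X φ)

/-- The action of `Y ↦ D(X, Y)` on Hom objects. -/
def homModuleMap (Y Z : D) : (Y ⟶[C] Z) ⟶ (homModule hφ Y ⟶[C] homModule hφ Z) :=
  RightMod.homOfAct (revComp X Y Z) (by
    rw [← homStrength_id, tensorObj_act_homStrength])

lemma actOf_comp_homModuleMap {z : C} {Y Z : D} (g : z ⟶ (Y ⟶[C] Z)) :
    RightMod.actOf (g ≫ homModuleMap hφ Y Z) = homStrength X g := by
  rw [RightMod.actOf_comp, homModuleMap, RightMod.actOf_homOfAct, homStrength_eq_revComp]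

lemma homTranspose_homModuleMap {z : C} {Y Z : D} (g : z ⟶ (Y ⟶[C] Z)) :
    RightMod.homTranspose (g ≫ homModuleMap hφ Y Z) = (X ⟶[C] Y) ◁ g ≫ eComp C X Y Z := by
  rw [RightMod.homTranspose_comp, homModuleMap, RightMod.homTranspose_homOfAct, revComp,
    SymmetricCategory.symmetry_assoc]

/-- The comparison functor `Y ↦ D(X, Y)` with values in right modules. -/
def homModuleFunctor : EnrichedFunctor C D (RightMod b) where
  obj Y := homModule hφ Y
  map Y Z := homModuleMap hφ Y Z
  map_id Y := RightMod.mapOf_injective (by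
    rw [RightMod.mapOf, homTranspose_homModuleMap, e_comp_id, RightMod.mapOf_eId])
  map_comp Y Z W := RightMod.homTranspose_injective (by
    have h (Y Z : D) := homTranspose_homModuleMap hφ (𝟙 (Y ⟶[C] Z))
    simp only [Category.id_comp, MonoidalCategory.whiskerLeft_id] at h
    rw [homTranspose_homModuleMap, RightMod.homTranspose_tensor_eComp, h, h, e_assoc])

variable [IsIso φ] [Tensored C D] [HasCoequalizers (ForgetEnrichment C D)]

/-- The comparison functor is fully faithful on Hom objects: morphisms from `z` into both Hom
objects correspond to morphisms out of `z ⊛ Y`. -/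
lemma isIso_homModuleMap (hX : IsCompactGenerator C X) (Y W : D) :
    IsIso (homModuleMap hφ Y W) := by
  refine isIso_of_yoneda_map_bijective _ fun z => ?_
  have hη := isTensor_tensorUnit (C := C) z Y
  have hstr := (preservesTensors_homFunctor_iff X).1 hX.isCompactObject.preservesTensors z Y
  generalize tensorUnit (C := C) z Y = η at *
  generalize (Tensored.tensor (C := C) Y).obj z = T at *
  have hact (f : 𝟙_ C ⟶ (T ⟶[C] W)) :
      RightMod.actOf ((η ≫ post Y f) ≫ homModuleMap hφ Y W) = homStrength X η ≫ post X f := by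
    rw [actOf_comp_homModuleMap, homStrength_post]
  constructor
  · intro x₁ x₂ h
    obtain ⟨f₁, rfl⟩ := (hη W).2 x₁
    obtain ⟨f₂, rfl⟩ := (hη W).2 x₂
    have h2 : post X f₁ = post X f₂ := by
      have := congrArg RightMod.actOf h
      dsimp only at this
      rwa [hact, hact, cancel_epi] at this
    rw [(existsUnique_post_eq hφ hX (post X f₂) (homModule_act_post hφ f₂)).unique h2 rfl]
  · intro h
    obtain ⟨f, hf, -⟩ := existsUnique_post_eq hφ hX (inv (homStrength X η) ≫ RightMod.actOf h) (by
      rw [← cancel_epi (homStrength X η ▷ b.X), ← Category.assoc,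
        ← tensorObj_act_homStrength, Category.assoc, IsIso.hom_inv_id_assoc,
        RightMod.act_actOf, ← comp_whiskerRight_assoc, IsIso.hom_inv_id_assoc])
    refine ⟨η ≫ post Y f, RightMod.actOf_injective ?_⟩
    dsimp only at hf ⊢
    rw [hact, hf, IsIso.hom_inv_id_assoc]

/-- The comparison functor of a compact generator is an equivalence. -/
lemma nonempty_enrichedEquivalence (hφ : IsEndHom X φ) (hX : IsCompactGenerator C X) :
    Nonempty (EnrichedEquivalence C D (RightMod b)) := by
  choose G θ hθ hlin _ using exists_represents hφ hX.isCompactObject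
  have : ∀ Y Z, IsIso ((homModuleFunctor hφ).map Y Z) := isIso_homModuleMap hφ hX
  exact ⟨equivalenceOfFullyFaithful (homModuleFunctor hφ) G fun M =>
    (RightMod.areInverse_ofMap (N := homModule hφ (G M)) (asIso (θ M)) (hlin M)).symm⟩

end Comparison

end EnrichedMorita

end

theorem theorem1p3 {C : Type u} [Category.{v} C] [MonoidalCategory C] [SymmetricCategory C]
    [MonoidalClosed C] [HasFiniteLimits C] [HasFiniteColimits C] (b : Mon C)
    {D : Type w₁} [EnrichedCategory C D] [EnrichedMorita.Tensored C D]
    [HasCoequalizers (ForgetEnrichment C D)] :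
    Nonempty (EnrichedMorita.EnrichedEquivalence C D (EnrichedMorita.RightMod b)) ↔
      ∃ X : D, EnrichedMorita.IsCompactGenerator C X ∧
        Nonempty (b ≅ EnrichedMorita.endMonoid C X) := by
  constructor
  · rintro ⟨E⟩
    exact E.exists_isCompactGenerator
  · rintro ⟨X, hX, ⟨φ⟩⟩
    let ψ : b.X ⟶ (X ⟶[C] X) := φ.hom.hom
    have : IsIso ψ := inferInstanceAs (IsIso ((Mon.forget C).map φ.hom))
    exact EnrichedMorita.nonempty_enrichedEquivalence (X := X) (φ := ψ)
      ⟨IsMonHom.one_hom φ.hom.hom, IsMonHom.mul_hom φ.hom.hom⟩ hX
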